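/- Let $\Bbbk$ be a field and let $I$ be a monomial ideal in the polynomial ring $R=\Bbbk[x_1,\dots,x_m]$ with its standard $\mathbb Z^m$-grading. Then there exist a finite poset $Q$ that is a homology CW-poset over $\Bbbk$ and a morphism of posets $\deg\colon Q\to\mathbb Z^m$ (where $\mathbb Z^m$ is ordered coordinatewise) such that the minimal free $\mathbb Z^m$-graded resolution of $I$ over $R$ is isomorphic, as a chain complex of $\mathbb Z^m$-graded $R$-modules, to the homogenization with respect to $\deg$ of the conic chain complex $\mathcal C_\bullet(Q,\Bbbk)$. (That is, this homogenization is a minimal free $\mathbb Z^m$-graded resolution of $I$, and every minimal free $\mathbb Z^m$-graded resolution of $I$ is isomorphic to it.) Here, for a finite poset $Q$, $\Delta(Q)$ denotes the order complex of $Q$, whose faces are the chains of $Q$ (the empty one included). For $a\in Q$ put $Q_{\le a}=\{x\in Q: x\le a\}$, $Q_{<a}=\{x\in Q: x<a\}$, $\Delta_{\le a}=\Delta(Q_{\le a})$, $\Delta_{<a}=\Delta(Q_{<a})$ and $d(a)=\dim\Delta_{\le a}$. The poset $Q$ is a *homology CW-poset over $\Bbbk$* if for every $a\in Q$ and every $i\ge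 -1$ the reduced homology $\widetilde H_i(\Delta_{<a};\Bbbk)$ is isomorphic to $\Bbbk$ if $i=\dim\Delta_{<a}$, and is $0$ otherwise (with $\dim\{\emptyset\}=-1$). Let $\Delta^n$ be the order complex of $\{a\in Q: d(a)\le n\}$. The *conic chain complex* $\mathcal C_\bullet(Q,\Bbbk)$ has $\mathcal C_n(Q,\Bbbk)=H_n(\Delta^n,\Delta^{n-1};\Bbbk)$ for $n\ge0$, and for $n\ge 1$ its differential $\partial_n$ is the composition of the canonical maps $H_n(\Delta^n,\Delta^{n-1};\Bbbk)\to\widetilde H_{n-1}(\Delta^{n-1};\Bbbk)\to H_{n-1}(\Delta^{n-1},\Delta^{n-2};\Bbbk)$. There is a decomposition $\mathcal C_n(Q,\Bbbk)=\bigoplus_{a\in Q}\mathcal C_{n,a}$, where $\mathcal C_{n,a}$ is the image of $H_n(\Delta_{\le a},\Delta_{<a};\Bbbk)$ if $d(a)=n$, and $\mathcal C_{n,a}=0$ otherwise; for $x\in\mathcal C_{n,a}$ the component $\partial_n^b(x)\in\mathcal C_{n-1,b}$ of $\partial_n(x)$ is zero unless $b\le a$. The *homogenization* of $\mathcal C_\bullet(Q,\Bbbk)$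 with respect to $\deg$ is the chain complex of $\mathbb Z^m$-graded $R$-modules with $n$-th term $\bigoplus_{a\in Q}\mathcal C_{n,a}\otimes_\Bbbk R(-\deg a)$, where $R(-\gamma)_\alpha=R_{\alpha-\gamma}$, and with differential $x\otimes 1\mapsto\sum_{b\le a}\partial_n^b(x)\otimes x^{\deg a-\deg b}$ for $x\in\mathcal C_{n,a}$. -/

import Mathlib

open scoped TensorProduct DirectSum

universe u v w

namespace ConicRes

/-! ## Order complexes and their chains

`OrderFace P n` is the set of faces with `n` vertices, i.e. of dimension `n - 1`, of the order
complex `Δ(P)`; a face is oriented by listing its vertices in decreasing order. For `n = 0` it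
consists of the empty face only. For a subset `S` of `P`, the faces of the order complex `Δ(S)` are
the faces of `Δ(P)` with all vertices in `S`. -/

/-- Oriented faces with `n` vertices of the order complex of `P`. -/
def OrderFace (P : Type w) [PartialOrder P] (n : ℕ) : Type w :=
  {s : Fin n → P // StrictAnti s}

section Chains

variable {P : Type w} [PartialOrder P]

/-- The face obtained by omitting the `i`-th vertex. -/
def OrderFace.face {n : ℕ} (s : OrderFace P (n + 1)) (i : Fin (n + 1)) : OrderFace P n :=
  ⟨fun j => s.1 (i.succAbove j), fun _ _ h => s.2 (Fin.strictMono_succAbove i h)⟩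

variable (k : Type u) [CommRing k]

/-- The module of oriented simplicial chains of `Δ(P)` spanned by the faces with `n` vertices, that
is, of chains of dimension `n - 1`; for `n = 0` it is spanned by the empty face. This is
`OrderFace P n →₀ k`; the zero of `k` is spelled out so that instances for quotients are found. -/
abbrev Chain (P : Type w) [PartialOrder P] (n : ℕ) : Type (max u w) :=
  @Finsupp (OrderFace P n) k AddCommGroup.toAddCommMonoid.toAddMonoid.toAddZeroClass.toAddZero.toZero

/-- The simplicial boundary map `[a₀, …, aₙ] ↦ ∑ᵢ (-1)ⁱ [a₀, …, âᵢ, …, aₙ]`. -/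
noncomputable def boundary (n : ℕ) : Chain k P (n + 1) →ₗ[k] Chain k P n :=
  Finsupp.linearCombination k fun s =>
    ∑ i : Fin (n + 1), (-1 : k) ^ (i : ℕ) • Finsupp.single (s.face i) (1 : k)

/-- The chains of the subcomplex `Δ(S)` of `Δ(P)`. -/
def chainsIn (S : Set P) (n : ℕ) : Submodule k (Chain k P n) :=
  Finsupp.supported k k {s : OrderFace P n | ∀ i, s.1 i ∈ S}

lemma chainsIn_mono {S S' : Set P} (h : S ⊆ S') (n : ℕ) : chainsIn k S n ≤ chainsIn k S' n :=
  Finsupp.supported_mono fun _ hs i => h (hs i)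

lemma boundary_single {n : ℕ} (s : OrderFace P (n + 1)) (c : k) :
    boundary k n (Finsupp.single s c) =
      ∑ i : Fin (n + 1), Finsupp.single (s.face i) (c * (-1 : k) ^ (i : ℕ)) := by
  simp [boundary, Finsupp.linearCombination_single, Finset.smul_sum]

lemma boundary_mem {S : Set P} {n : ℕ} {c : Chain k P (n + 1)} (hc : c ∈ chainsIn k S (n + 1)) :
    boundary k n c ∈ chainsIn k S n := by
  have h : chainsIn k S (n + 1) ≤ (chainsIn k S n).comap (boundary k n) := by
    rw [chainsIn, Finsupp.supported_eq_span_single, Submodule.span_le]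
    rintro _ ⟨s, hs, rfl⟩
    change boundary k n (Finsupp.single s 1) ∈ chainsIn k S n
    rw [boundary_single]
    exact Submodule.sum_mem _ fun i _ =>
      Finsupp.single_mem_supported k _ (fun j => hs (i.succAbove j))
  exact h hc

lemma boundary_boundary {n : ℕ} (c : Chain k P (n + 2)) :
    boundary k n (boundary k (n + 1) c) = 0 := by
  have h : (boundary k n (P := P)) ∘ₗ boundary k (n + 1) = 0 := by
    refine Finsupp.lhom_ext fun s c => ?_
    simp only [LinearMap.comp_apply, LinearMap.zero_apply, boundary_single, map_sum]
    rw [← Finset.sum_product', ← Finset.univ_product_univ.symm]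
    refine Finset.sum_involution (fun p _ => (p.1.succAbove p.2, p.2.predAbove p.1)) ?_ ?_ ?_ ?_
    · rintro ⟨i, j⟩ -
      have h1 : (s.face (i.succAbove j)).face (j.predAbove i) = (s.face i).face j := by
        apply Subtype.ext
        funext l
        simp only [OrderFace.face]
        rw [Fin.succAbove_succAbove_succAbove_predAbove]
      have h2 := Fin.neg_one_pow_succAbove_add_predAbove (R := k) i j
      simp only [h1]
      rw [← Finsupp.single_add, mul_assoc, mul_assoc, ← pow_add, ← pow_add, h2]
      simp
    · rintro ⟨i, j⟩ - - h
      exact Fin.succAbove_ne i j (congrArg Prod.fst h)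
    · simp
    · rintro ⟨i, j⟩ -
      simp [Fin.succAbove_succAbove_predAbove, Fin.predAbove_predAbove_succAbove]
  exact LinearMap.congr_fun h c

/-! ## Relative and reduced homology of order complexes -/

/-- Relative cycles of dimension `n` of the pair `(Δ(S), Δ(T))`: chains of `Δ(S)` with boundary in
`Δ(T)`. -/
noncomputable def relCycles (S T : Set P) (n : ℕ) : Submodule k (Chain k P (n + 1)) :=
  chainsIn k S (n + 1) ⊓ (chainsIn k T n).comap (boundary k n)

/-- Relative boundaries of dimension `n` of the pair `(Δ(S), Δ(T))`. -/
noncomputable def relBoundaries (S T : Set P) (n : ℕ) : Submodule k (Chain k P (n + 1)) :=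
  (chainsIn k S (n + 2)).map (boundary k (n + 1)) ⊔ chainsIn k T (n + 1)

/-- The relative homology `H_n(Δ(S), Δ(T); k)`, for `T ⊆ S`. -/
def RelHomology (S T : Set P) (n : ℕ) : Type (max u w) :=
  ↥(relCycles k S T n) ⧸ (relBoundaries k S T n).submoduleOf (relCycles k S T n)

noncomputable instance (S T : Set P) (n : ℕ) : AddCommGroup (RelHomology k S T n) :=
  inferInstanceAs (AddCommGroup
    (↥(relCycles k S T n) ⧸ (relBoundaries k S T n).submoduleOf (relCycles k S T n)))

noncomputable instance (S T : Set P) (n : ℕ) : Module k (RelHomology k S T n) :=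
  inferInstanceAs (Module k
    (↥(relCycles k S T n) ⧸ (relBoundaries k S T n).submoduleOf (relCycles k S T n)))

/-- The class of a relative cycle. -/
noncomputable def relMk (S T : Set P) (n : ℕ) : relCycles k S T n →ₗ[k] RelHomology k S T n :=
  ((relBoundaries k S T n).submoduleOf (relCycles k S T n)).mkQ

lemma relMk_surjective (S T : Set P) (n : ℕ) : Function.Surjective (relMk k S T n) :=
  Submodule.mkQ_surjective _

lemma relMk_eq_zero_iff (S T : Set P) (n : ℕ) (z : relCycles k S T n) :
    relMk k S T n z = 0 ↔ (z : Chain k P (n + 1)) ∈ relBoundaries k S T n :=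
  Submodule.Quotient.mk_eq_zero _

/-- A map of relative cycles that maps boundaries to boundaries induces a map in homology. -/
noncomputable def relLift {S T S' T' : Set P} {n n' : ℕ}
    (f : relCycles k S T n →ₗ[k] relCycles k S' T' n')
    (hf : ∀ z : relCycles k S T n, (z : Chain k P (n + 1)) ∈ relBoundaries k S T n →
      (f z : Chain k P (n' + 1)) ∈ relBoundaries k S' T' n') :
    RelHomology k S T n →ₗ[k] RelHomology k S' T' n' :=
  Submodule.mapQ ((relBoundaries k S T n).submoduleOf (relCycles k S T n))
    ((relBoundaries k S' T' n').submoduleOf (relCycles k S' T' n')) f fun z hz => hf z hz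

lemma relLift_mk {S T S' T' : Set P} {n n' : ℕ}
    (f : relCycles k S T n →ₗ[k] relCycles k S' T' n')
    (hf : ∀ z : relCycles k S T n, (z : Chain k P (n + 1)) ∈ relBoundaries k S T n →
      (f z : Chain k P (n' + 1)) ∈ relBoundaries k S' T' n') (z : relCycles k S T n) :
    relLift k f hf (relMk k S T n z) = relMk k S' T' n' (f z) := rfl

/-- The map `H_n(Δ(S), Δ(T)) → H_n(Δ(S'), Δ(T'))` induced by inclusions. -/
noncomputable def relMap {S S' T T' : Set P} (hS : S ⊆ S') (hT : T ⊆ T') (n : ℕ) :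
    RelHomology k S T n →ₗ[k] RelHomology k S' T' n :=
  relLift k
    (Submodule.inclusion (inf_le_inf (chainsIn_mono k hS _)
      (Submodule.comap_mono (chainsIn_mono k hT _))))
    (fun _ hx => by
      have hle : relBoundaries k S T n ≤ relBoundaries k S' T' n :=
        sup_le_sup (Submodule.map_mono (chainsIn_mono k hS _)) (chainsIn_mono k hT _)
      exact hle hx)

/-- The boundary map on relative cycles. -/
noncomputable def relCyclesBoundary (S T U : Set P) (n : ℕ) :
    relCycles k S T (n + 1) →ₗ[k] relCycles k T U n :=
  (boundary k (n + 1)).restrict fun z hz => by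
    refine ⟨hz.2, ?_⟩
    change boundary k n (boundary k (n + 1) z) ∈ chainsIn k U n
    rw [boundary_boundary]
    exact Submodule.zero_mem _

/-- The map `H_{n+1}(Δ(S), Δ(T)) → H_n(Δ(T), Δ(U))` sending the class of `z` to the class of `∂z`.
It is the composition of the connecting map `H_{n+1}(Δ(S), Δ(T)) → H_n(Δ(T))` and the canonical map
`H_n(Δ(T)) → H_n(Δ(T), Δ(U))` from the long exact sequences of the pairs. -/
noncomputable def relConnecting (S T U : Set P) (n : ℕ) :
    RelHomology k S T (n + 1) →ₗ[k] RelHomology k T U n :=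
  relLift k (relCyclesBoundary k S T U n) (by
    rintro ⟨x, hx⟩ hxb
    change boundary k (n + 1) x ∈ relBoundaries k T U n
    obtain ⟨y, ⟨y', -, rfl⟩, t, ht, rfl⟩ := Submodule.mem_sup.1 hxb
    rw [map_add, boundary_boundary, zero_add]
    exact Submodule.mem_sup_left ⟨t, ht, rfl⟩)

/-- Cycles of `Δ(S)` spanned by faces with `n` vertices, in the augmented chain complex. -/
noncomputable def redCycles (S : Set P) : (n : ℕ) → Submodule k (Chain k P n)
  | 0 => chainsIn k S 0
  | n + 1 => chainsIn k S (n + 1) ⊓ LinearMap.ker (boundary k n)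

/-- The reduced homology of `Δ(S)` at the faces with `n` vertices, that is, the module
`H̃_{n-1}(Δ(S); k)`. -/
def RedHomology (S : Set P) (n : ℕ) : Type (max u w) :=
  ↥(redCycles k S n) ⧸
    ((chainsIn k S (n + 1)).map (boundary k n)).submoduleOf (redCycles k S n)

noncomputable instance (S : Set P) (n : ℕ) : AddCommGroup (RedHomology k S n) :=
  inferInstanceAs (AddCommGroup (↥(redCycles k S n) ⧸
    ((chainsIn k S (n + 1)).map (boundary k n)).submoduleOf (redCycles k S n)))

noncomputable instance (S : Set P) (n : ℕ) : Module k (RedHomology k S n) :=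
  inferInstanceAs (Module k (↥(redCycles k S n) ⧸
    ((chainsIn k S (n + 1)).map (boundary k n)).submoduleOf (redCycles k S n)))

/-- `Δ(S)` has the reduced homology over `k` of a sphere of dimension `dim Δ(S)`. The largest number
of vertices of a face of `Δ(S)` is `S.chainHeight (· < ·) = dim Δ(S) + 1`. -/
def IsHomologySphere (S : Set P) : Prop :=
  ∀ n : ℕ,
    ((n : ℕ∞) = S.chainHeight (· < ·) → Nonempty (RedHomology k S n ≃ₗ[k] k)) ∧
    ((n : ℕ∞) ≠ S.chainHeight (· < ·) → Subsingleton (RedHomology k S n))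

/-- A homology CW-poset over `k` (finiteness of the poset is required separately): every open filter
`P_{<a}` is a homology sphere over `k`. -/
def IsHCWPoset (k : Type u) [CommRing k] (P : Type w) [PartialOrder P] : Prop :=
  ∀ a : P, IsHomologySphere k (Set.Iio a)

end Chains

/-! ## Graded chain complexes -/

section Internal

lemma isInternal_of_proj {ι M σ : Type*} [DecidableEq ι] [AddCommMonoid M] [SetLike σ M]
    [AddSubmonoidClass σ M] (N : ι → σ) (π : ι → M →+ M)
    (h2 : ∀ i, ∀ x ∈ N i, π i x = x)
    (h3 : ∀ i j, i ≠ j → ∀ x ∈ N i, π j x = 0)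
    (h4 : ∀ x, x ∈ AddSubmonoid.closure {y | ∃ i, y ∈ N i}) : DirectSum.IsInternal N := by
  have key : ∀ (j : ι) (x : ⨁ i, N i),
      π j (DirectSum.coeAddMonoidHom N x) = ((x j : N j) : M) := by
    intro j x
    induction x using DirectSum.induction_on with
    | zero => simp
    | of i x =>
      rw [DirectSum.coeAddMonoidHom_of]
      by_cases hij : i = j
      · subst hij
        rw [h2 i x x.2, DirectSum.of_eq_same]
      · rw [h3 i j hij x x.2, DirectSum.of_eq_of_ne _ _ _ (Ne.symm hij)]
        rfl
    | add x y hx hy => rw [map_add, map_add, hx, hy, DirectSum.add_apply]; rfl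
  constructor
  · intro x y hxy
    refine DFinsupp.ext fun j => Subtype.ext ?_
    have hx := key j x
    rw [hxy, key j y] at hx
    exact hx.symm
  · intro x
    have hle : AddSubmonoid.closure {y | ∃ i, y ∈ N i} ≤
        AddMonoidHom.mrange (DirectSum.coeAddMonoidHom N) := by
      rw [AddSubmonoid.closure_le]
      rintro y ⟨i, hy⟩
      exact ⟨DirectSum.of (fun i => N i) i ⟨y, hy⟩, DirectSum.coeAddMonoidHom_of _ _ _⟩
    exact hle (h4 x)

variable {k : Type u} [CommRing k] {ι : Type w} {M : Type v} [AddCommGroup M] [Module k M]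

open scoped Classical in
/-- The projection of `M` onto the `i`-th summand of an internal direct sum decomposition. -/
noncomputable def internalProj {N : ι → Submodule k M} (h : DirectSum.IsInternal N) (i : ι) :
    M →ₗ[k] N i :=
  DirectSum.component k ι (fun i => N i) i ∘ₗ
    (LinearEquiv.ofBijective (DirectSum.coeLinearMap N) h).symm.toLinearMap

open scoped Classical in
lemma internalProj_self {N : ι → Submodule k M} (h : DirectSum.IsInternal N) {i : ι} {x : M}
    (hx : x ∈ N i) : internalProj h i x = ⟨x, hx⟩ :=
  h.ofBijective_coeLinearMap_of_mem hx

open scoped Classical in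
lemma internalProj_of_ne {N : ι → Submodule k M} (h : DirectSum.IsInternal N) {i j : ι}
    (hij : i ≠ j) {x : M} (hx : x ∈ N i) : internalProj h j x = 0 :=
  h.ofBijective_coeLinearMap_of_mem_ne hij hx

open scoped Classical in
lemma sum_internalProj [Fintype ι] {N : ι → Submodule k M} (h : DirectSum.IsInternal N) (x : M) :
    ∑ i, (internalProj h i x : M) = x := by
  have hx : x ∈ ⨆ i, N i := by rw [h.submodule_iSup_eq_top]; trivial
  induction hx using Submodule.iSup_induction' with
  | mem i x hx =>
    rw [Finset.sum_eq_single i]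
    · rw [internalProj_self h hx]
    · intro j _ hj
      rw [internalProj_of_ne h (Ne.symm hj) hx]
      rfl
    · simp
  | zero => simp
  | add x y _ _ hx hy =>
    simp only [map_add, Submodule.coe_add, Finset.sum_add_distrib, hx, hy]

end Internal

open scoped Classical in
/-- A non-negatively graded chain complex of `k`-modules together with a `P`-grading: for each `n` a
direct sum decomposition `X n = ⨁ₐ comp n a`, such that for `x ∈ comp (n+1) a` the component of
`d x` in `comp n b` vanishes when `b ≰ a`. -/
structure PGradedComplex (k : Type u) [CommRing k] (P : Type w) [PartialOrder P] where
  /-- the modules of the complex -/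
  X : ℕ → Type v
  [addCommGroup : ∀ n, AddCommGroup (X n)]
  [module : ∀ n, Module k (X n)]
  /-- the differential -/
  d : ∀ n, X (n + 1) →ₗ[k] X n
  d_comp_d : ∀ n x, d n (d (n + 1) x) = 0
  /-- the components of the `P`-grading -/
  comp : ∀ n, P → Submodule k (X n)
  isInternal : ∀ n, DirectSum.IsInternal (comp n)
  d_triangular : ∀ n a b, ¬ b ≤ a → ∀ x ∈ comp (n + 1) a,
    internalProj (isInternal n) b (d n x) = 0

attribute [instance] PGradedComplex.addCommGroup PGradedComplex.module

/-- The standard `ℤ^m`-grading of `k[x_1, …, x_m]`: the component of degree `α` is spanned by the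
monomial `x^α` if `α ≥ 0`, and is zero otherwise. -/
noncomputable abbrev polyGrade (k : Type u) [CommRing k] (m : ℕ) (α : Fin m → ℤ) :
    Submodule k (MvPolynomial (Fin m) k) :=
  MvPolynomial.weightedHomogeneousSubmodule k (fun i : Fin m => (Pi.single i 1 : Fin m → ℤ)) α

/-- A non-negatively graded chain complex of `ℤ^m`-graded modules over `k[x_1, …, x_m]`, with
differential homogeneous of degree `0`. -/
structure MultigradedComplex (k : Type u) [CommRing k] (m : ℕ) where
  /-- the modules of the complex -/
  X : ℕ → Type v
  [addCommGroup : ∀ n, AddCommGroup (X n)]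
  [module : ∀ n, Module (MvPolynomial (Fin m) k) (X n)]
  /-- the homogeneous components -/
  grade : ∀ n, (Fin m → ℤ) → AddSubgroup (X n)
  isInternal : ∀ n, DirectSum.IsInternal (grade n)
  smul_mem : ∀ n α β, ∀ p ∈ polyGrade k m α, ∀ x ∈ grade n β, p • x ∈ grade n (α + β)
  /-- the differential -/
  d : ∀ n, X (n + 1) →ₗ[MvPolynomial (Fin m) k] X n
  d_comp_d : ∀ n x, d n (d (n + 1) x) = 0
  d_mem : ∀ n α, ∀ x ∈ grade (n + 1) α, d n x ∈ grade n α

attribute [instance] MultigradedComplex.addCommGroup MultigradedComplex.module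

namespace MultigradedComplex

variable {k : Type u} [CommRing k] {m : ℕ}

/-- Isomorphisms of chain complexes of `ℤ^m`-graded modules. -/
structure Iso (F : MultigradedComplex.{u, v} k m) (G : MultigradedComplex.{u, w} k m) where
  /-- the isomorphisms in each homological degree -/
  equiv : ∀ n, F.X n ≃ₗ[MvPolynomial (Fin m) k] G.X n
  comm : ∀ n x, equiv n (F.d n x) = G.d n (equiv (n + 1) x)
  mem_grade_iff : ∀ n α x, equiv n x ∈ G.grade n α ↔ x ∈ F.grade n α

/-- `F` is a minimal `ℤ^m`-graded free resolution of the ideal `I`: every `F_n` has a finite basis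
of homogeneous elements, `⋯ → F_1 → F_0 → I → 0` is exact for some surjective homomorphism
`ε : F_0 → I` of degree `0`, and `d(F_{n+1}) ⊆ (x_1, …, x_m) F_n` for all `n`. -/
structure IsMinimalFreeResolution (F : MultigradedComplex.{u, v} k m)
    (I : Ideal (MvPolynomial (Fin m) k)) : Prop where
  free : ∀ n, ∃ (r : ℕ) (b : Module.Basis (Fin r) (MvPolynomial (Fin m) k) (F.X n)),
    ∀ i, ∃ α, b i ∈ F.grade n α
  augmentation : ∃ ε : F.X 0 →ₗ[MvPolynomial (Fin m) k] I,
    Function.Surjective ε ∧ LinearMap.ker ε = LinearMap.range (F.d 0) ∧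
      ∀ α, ∀ x ∈ F.grade 0 α, (ε x : MvPolynomial (Fin m) k) ∈ polyGrade k m α
  exact : ∀ n, LinearMap.ker (F.d n) = LinearMap.range (F.d (n + 1))
  minimal : ∀ n, LinearMap.range (F.d n) ≤
    Ideal.span (Set.range (MvPolynomial.X : Fin m → MvPolynomial (Fin m) k)) •
      (⊤ : Submodule (MvPolynomial (Fin m) k) (F.X n))

end MultigradedComplex

/-- A monomial ideal: an ideal generated by monomials. -/
def IsMonomialIdeal {k : Type u} [CommRing k] {m : ℕ} (I : Ideal (MvPolynomial (Fin m) k)) : Prop :=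
  ∃ S : Set (Fin m →₀ ℕ), I = Ideal.span ((fun s => MvPolynomial.monomial s (1 : k)) '' S)

/-! ## Homogenization -/

/-- The monomial `x^β`, for `β ∈ ℤ^m` with `β ≥ 0`. -/
noncomputable def xpow (k : Type u) [CommRing k] {m : ℕ} (β : Fin m → ℤ) :
    MvPolynomial (Fin m) k :=
  MvPolynomial.monomial (Finsupp.equivFunOnFinite.symm fun i => (β i).toNat) 1

lemma xpow_mem (k : Type u) [CommRing k] {m : ℕ} {β : Fin m → ℤ} (h : 0 ≤ β) :
    xpow k β ∈ polyGrade k m β := by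
  refine MvPolynomial.isWeightedHomogeneous_monomial _ _ _ ?_
  funext i
  have hi : (0 : ℤ) ≤ β i := h i
  simp [Finsupp.weight_apply, Finsupp.sum_fintype, Finset.sum_apply, Pi.single_apply, hi]

lemma xpow_mul (k : Type u) [CommRing k] {m : ℕ} {β γ : Fin m → ℤ} (hβ : 0 ≤ β) (hγ : 0 ≤ γ) :
    xpow k β * xpow k γ = xpow k (β + γ) := by
  rw [xpow, xpow, xpow, MvPolynomial.monomial_mul, one_mul]
  refine congrArg (fun e => MvPolynomial.monomial e (1 : k)) ?_
  refine Finsupp.ext fun i => ?_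
  exact (Int.toNat_add (hβ i) (hγ i)).symm

/-- For a `k`-module `V`, the homogeneous component of degree `α` of the `ℤ^m`-graded module
`R ⊗ V`, where `R = k[x_1, …, x_m]` and `V` sits in degree `0`. -/
noncomputable def tensorGrade (k : Type u) [CommRing k] {m : ℕ} (V : Type v) [AddCommGroup V]
    [Module k V] (α : Fin m → ℤ) : Submodule k (MvPolynomial (Fin m) k ⊗[k] V) :=
  LinearMap.range (LinearMap.rTensor V (polyGrade k m α).subtype)

lemma tensorGrade_eq_span (k : Type u) [CommRing k] {m : ℕ} (V : Type v) [AddCommGroup V]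
    [Module k V] (α : Fin m → ℤ) :
    tensorGrade k V α = Submodule.span k
      {t : MvPolynomial (Fin m) k ⊗[k] V | ∃ p ∈ polyGrade k m α, ∃ x : V, p ⊗ₜ[k] x = t} := by
  apply le_antisymm
  · rintro _ ⟨t, rfl⟩
    induction t using TensorProduct.induction_on with
    | zero => simp
    | tmul p x => exact Submodule.subset_span ⟨p, p.2, x, rfl⟩
    | add s t hs ht => rw [map_add]; exact Submodule.add_mem _ hs ht
  · rw [Submodule.span_le]
    rintro _ ⟨p, hp, x, rfl⟩
    exact ⟨⟨p, hp⟩ ⊗ₜ x, rfl⟩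

/-- The projection of `R ⊗ V` to the component of degree `α`. -/
noncomputable def tensorProj (k : Type u) [CommRing k] {m : ℕ} (V : Type v) [AddCommGroup V]
    [Module k V] (α : Fin m → ℤ) :
    MvPolynomial (Fin m) k ⊗[k] V →ₗ[k] MvPolynomial (Fin m) k ⊗[k] V :=
  LinearMap.rTensor V (MvPolynomial.weightedHomogeneousComponent
    (fun i : Fin m => (Pi.single i 1 : Fin m → ℤ)) α)

lemma tensorProj_self {k : Type u} [CommRing k] {m : ℕ} {V : Type v} [AddCommGroup V]
    [Module k V] {α : Fin m → ℤ} {t : MvPolynomial (Fin m) k ⊗[k] V} (ht : t ∈ tensorGrade k V α) :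
    tensorProj k V α t = t := by
  rw [tensorGrade_eq_span] at ht
  induction ht using Submodule.span_induction with
  | mem t ht =>
    obtain ⟨p, hp, x, rfl⟩ := ht
    rw [tensorProj, LinearMap.rTensor_tmul,
      MvPolynomial.weightedHomogeneousComponent_of_mem hp, if_pos rfl]
  | zero => simp
  | add s t _ _ hs ht => rw [map_add, hs, ht]
  | smul c t _ ht => rw [map_smul, ht]

lemma tensorProj_of_ne {k : Type u} [CommRing k] {m : ℕ} {V : Type v} [AddCommGroup V]
    [Module k V] {α β : Fin m → ℤ} (h : α ≠ β) {t : MvPolynomial (Fin m) k ⊗[k] V}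
    (ht : t ∈ tensorGrade k V α) : tensorProj k V β t = 0 := by
  rw [tensorGrade_eq_span] at ht
  induction ht using Submodule.span_induction with
  | mem t ht =>
    obtain ⟨p, hp, x, rfl⟩ := ht
    rw [tensorProj, LinearMap.rTensor_tmul,
      MvPolynomial.weightedHomogeneousComponent_of_mem hp, if_neg (Ne.symm h),
      TensorProduct.zero_tmul]
  | zero => simp
  | add s t _ _ hs ht => rw [map_add, hs, ht, add_zero]
  | smul c t _ ht => rw [map_smul, ht, smul_zero]

lemma smul_mem_tensorGrade {k : Type u} [CommRing k] {m : ℕ} {V : Type v} [AddCommGroup V]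
    [Module k V] {α β γ : Fin m → ℤ} {p : MvPolynomial (Fin m) k} (hp : p ∈ polyGrade k m α)
    {t : MvPolynomial (Fin m) k ⊗[k] V} (ht : t ∈ tensorGrade k V β) (h : α + β = γ) :
    p • t ∈ tensorGrade k V γ := by
  subst h
  rw [tensorGrade_eq_span] at ht ⊢
  induction ht using Submodule.span_induction with
  | mem t ht =>
    obtain ⟨q, hq, x, rfl⟩ := ht
    rw [TensorProduct.smul_tmul']
    exact Submodule.subset_span ⟨p • q, hp.mul hq, x, rfl⟩
  | zero => simp
  | add s t _ _ hs ht => rw [smul_add]; exact Submodule.add_mem _ hs ht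
  | smul c t _ ht => rw [smul_comm]; exact Submodule.smul_mem _ _ ht

lemma baseChange_mem_tensorGrade {k : Type u} [CommRing k] {m : ℕ} {V : Type v} {W : Type w}
    [AddCommGroup V] [Module k V] [AddCommGroup W] [Module k W] (f : V →ₗ[k] W) {α : Fin m → ℤ}
    {t : MvPolynomial (Fin m) k ⊗[k] V} (ht : t ∈ tensorGrade k V α) :
    f.baseChange (MvPolynomial (Fin m) k) t ∈ tensorGrade k W α := by
  rw [tensorGrade_eq_span] at ht ⊢
  induction ht using Submodule.span_induction with
  | mem t ht =>
    obtain ⟨p, hp, x, rfl⟩ := ht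
    exact Submodule.subset_span ⟨p, hp, f x, by rw [LinearMap.baseChange_tmul]⟩
  | zero => simp
  | add s t _ _ hs ht => rw [map_add]; exact Submodule.add_mem _ hs ht
  | smul c t _ ht =>
    rw [LinearMap.map_smul_of_tower]; exact Submodule.smul_mem _ _ ht

namespace PGradedComplex

variable {k : Type u} [CommRing k] {P : Type w} [PartialOrder P] {m : ℕ}

/-- The component `comp (n+1) a → comp n b` of the differential. -/
noncomputable def entry (F : PGradedComplex.{u, v, w} k P) (n : ℕ) (a b : P) :
    F.comp (n + 1) a →ₗ[k] F.comp n b :=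
  internalProj (F.isInternal n) b ∘ₗ F.d n ∘ₗ (F.comp (n + 1) a).subtype

lemma entry_eq_zero (F : PGradedComplex.{u, v, w} k P) (n : ℕ) {a b : P} (h : ¬ b ≤ a) :
    F.entry n a b = 0 :=
  LinearMap.ext fun x => F.d_triangular n a b h x x.2

lemma sum_entry_comp_entry [Fintype P] (F : PGradedComplex.{u, v, w} k P) (n : ℕ) (a c : P) :
    ∑ b, F.entry n b c ∘ₗ F.entry (n + 1) a b = 0 := by
  ext x
  have h := F.d_comp_d n x
  rw [← sum_internalProj (F.isInternal (n + 1)) (F.d (n + 1) x), map_sum] at h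
  have h' := congrArg (internalProj (F.isInternal n) c) h
  rw [map_sum, map_zero] at h'
  simp only [LinearMap.sum_apply, LinearMap.comp_apply, LinearMap.zero_apply]
  exact congrArg Subtype.val h'

/-- The modules `⨁ₐ R ⊗ F_{n,a}` underlying the homogenization of a `P`-graded complex. -/
abbrev HomX (F : PGradedComplex.{u, v, w} k P) (m n : ℕ) : Type (max u v w) :=
  ⨁ a : P, MvPolynomial (Fin m) k ⊗[k] F.comp n a

/-- The component of degree `α` of `⨁ₐ R(-deg a) ⊗ F_{n,a}`, using `R(-γ)_α = R_{α-γ}`. -/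
def homGrade (F : PGradedComplex.{u, v, w} k P) (deg : P →o (Fin m → ℤ)) (n : ℕ) (α : Fin m → ℤ) :
    AddSubgroup (F.HomX m n) where
  carrier := {x | ∀ a, x a ∈ tensorGrade k (F.comp n a) (α - deg a)}
  zero_mem' _ := Submodule.zero_mem _
  add_mem' hx hy a := Submodule.add_mem _ (hx a) (hy a)
  neg_mem' hx a := Submodule.neg_mem _ (hx a)

open scoped Classical in
/-- The differential of the homogenization: for `x ∈ F_{n+1,a}` it sends `1 ⊗ x` to
`∑_b x^{deg a - deg b} ⊗ f^b(x)`; here `f^b(x) = 0` unless `b ≤ a`. -/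
noncomputable def homD [Fintype P] (F : PGradedComplex.{u, v, w} k P) (deg : P →o (Fin m → ℤ))
    (n : ℕ) : F.HomX m (n + 1) →ₗ[MvPolynomial (Fin m) k] F.HomX m n :=
  DirectSum.toModule (MvPolynomial (Fin m) k) P _ fun a =>
    ∑ b : P, xpow k (deg a - deg b) •
      (DirectSum.lof (MvPolynomial (Fin m) k) P
        (fun b => MvPolynomial (Fin m) k ⊗[k] F.comp n b) b ∘ₗ
          (F.entry n a b).baseChange (MvPolynomial (Fin m) k))

open scoped Classical in
lemma lof_mem_homGrade (F : PGradedComplex.{u, v, w} k P) (deg : P →o (Fin m → ℤ)) (n : ℕ)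
    (α : Fin m → ℤ) (a : P) {t : MvPolynomial (Fin m) k ⊗[k] F.comp n a}
    (ht : t ∈ tensorGrade k (F.comp n a) (α - deg a)) :
    DirectSum.lof (MvPolynomial (Fin m) k) P
      (fun b => MvPolynomial (Fin m) k ⊗[k] F.comp n b) a t ∈ F.homGrade deg n α := by
  intro b
  by_cases hab : a = b
  · subst hab
    rw [DirectSum.lof_apply]
    exact ht
  · rw [DirectSum.lof_eq_of, DirectSum.of_eq_of_ne _ _ _ (Ne.symm hab)]
    exact Submodule.zero_mem _

open scoped Classical in
lemma homD_lof [Fintype P] (F : PGradedComplex.{u, v, w} k P) (deg : P →o (Fin m → ℤ)) (n : ℕ)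
    (a : P) (t : MvPolynomial (Fin m) k ⊗[k] F.comp (n + 1) a) :
    F.homD deg n (DirectSum.lof (MvPolynomial (Fin m) k) P
      (fun b => MvPolynomial (Fin m) k ⊗[k] F.comp (n + 1) b) a t) =
    ∑ b : P, xpow k (deg a - deg b) • DirectSum.lof (MvPolynomial (Fin m) k) P
      (fun b => MvPolynomial (Fin m) k ⊗[k] F.comp n b) b
        ((F.entry n a b).baseChange (MvPolynomial (Fin m) k) t) := by
  rw [homD, DirectSum.toModule_lof]
  simp [LinearMap.sum_apply]

open scoped Classical in
lemma homD_homD [Fintype P] (F : PGradedComplex.{u, v, w} k P) (deg : P →o (Fin m → ℤ)) (n : ℕ)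
    (x : F.HomX m (n + 2)) : F.homD deg n (F.homD deg (n + 1) x) = 0 := by
  suffices h : F.homD deg n ∘ₗ F.homD deg (n + 1) = 0 from LinearMap.congr_fun h x
  refine DirectSum.linearMap_ext _ fun a => LinearMap.ext fun t => ?_
  simp only [LinearMap.comp_apply, LinearMap.zero_apply]
  rw [homD_lof, map_sum]
  simp only [map_smul, homD_lof, Finset.smul_sum]
  rw [Finset.sum_comm]
  refine Finset.sum_eq_zero fun c _ => ?_
  have key : ∀ b : P, xpow k (deg a - deg b) • xpow k (deg b - deg c) •
      DirectSum.lof (MvPolynomial (Fin m) k) P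
        (fun b => MvPolynomial (Fin m) k ⊗[k] F.comp n b) c
        ((F.entry n b c).baseChange (MvPolynomial (Fin m) k)
          ((F.entry (n + 1) a b).baseChange (MvPolynomial (Fin m) k) t)) =
      xpow k (deg a - deg c) • DirectSum.lof (MvPolynomial (Fin m) k) P
        (fun b => MvPolynomial (Fin m) k ⊗[k] F.comp n b) c
        ((F.entry n b c ∘ₗ F.entry (n + 1) a b).baseChange (MvPolynomial (Fin m) k) t) := by
    intro b
    rw [LinearMap.baseChange_comp, LinearMap.comp_apply]
    by_cases hba : b ≤ a
    · by_cases hcb : c ≤ b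
      · rw [smul_smul, xpow_mul k (sub_nonneg.2 (deg.monotone hba))
          (sub_nonneg.2 (deg.monotone hcb)), sub_add_sub_cancel]
      · simp [F.entry_eq_zero n hcb]
    · simp [F.entry_eq_zero (n + 1) hba]
  rw [Finset.sum_congr rfl fun b _ => key b, ← Finset.smul_sum, ← map_sum, ← LinearMap.sum_apply]
  have hsum : ∑ b, (F.entry n b c ∘ₗ F.entry (n + 1) a b).baseChange (MvPolynomial (Fin m) k) =
      0 := by
    have h := congrArg (LinearMap.baseChangeHom k (MvPolynomial (Fin m) k) _ _)
      (F.sum_entry_comp_entry n a c)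
    rw [map_sum, map_zero] at h
    exact h
  rw [hsum]
  simp

lemma homD_mem [Fintype P] (F : PGradedComplex.{u, v, w} k P) (deg : P →o (Fin m → ℤ)) (n : ℕ)
    (α : Fin m → ℤ) (x : F.HomX m (n + 1)) (hx : x ∈ F.homGrade deg (n + 1) α) :
    F.homD deg n x ∈ F.homGrade deg n α := by
  classical
  have hx' : x = ∑ a : P, DirectSum.lof (MvPolynomial (Fin m) k) P
      (fun b => MvPolynomial (Fin m) k ⊗[k] F.comp (n + 1) b) a (x a) :=
    (DirectSum.sum_univ_of x).symm
  rw [hx', map_sum]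
  refine AddSubgroup.sum_mem _ fun a _ => ?_
  rw [homD_lof]
  refine AddSubgroup.sum_mem _ fun b _ => ?_
  by_cases hba : b ≤ a
  · rw [← map_smul]
    exact F.lof_mem_homGrade deg n α b (smul_mem_tensorGrade
      (xpow_mem k (sub_nonneg.2 (deg.monotone hba))) (baseChange_mem_tensorGrade _ (hx a))
      (by abel))
  · rw [F.entry_eq_zero n hba]
    simp

lemma homGrade_isInternal (F : PGradedComplex.{u, v, w} k P) (deg : P →o (Fin m → ℤ)) (n : ℕ) :
    DirectSum.IsInternal (F.homGrade deg n) := by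
  classical
  refine isInternal_of_proj _
    (fun α => DirectSum.map fun a => (tensorProj k (F.comp n a) (α - deg a)).toAddMonoidHom)
    ?_ ?_ ?_
  · intro α x hx
    refine DFinsupp.ext fun a => ?_
    exact tensorProj_self (hx a)
  · intro α β hαβ x hx
    refine DFinsupp.ext fun a => ?_
    exact tensorProj_of_ne (fun h => hαβ (sub_left_injective h)) (hx a)
  · intro x
    induction x using DirectSum.induction_on with
    | zero => exact AddSubmonoid.zero_mem _
    | add x y hx hy => exact AddSubmonoid.add_mem _ hx hy
    | of a t =>
      induction t using TensorProduct.induction_on with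
      | zero => rw [map_zero]; exact AddSubmonoid.zero_mem _
      | add s t hs ht => rw [map_add]; exact AddSubmonoid.add_mem _ hs ht
      | tmul p x =>
        have hp : p ∈ ⨆ α, polyGrade k m α := by
          rw [(@DirectSum.Decomposition.isInternal _ _ _ _ _ _ _ _
            (MvPolynomial.weightedDecomposition k
              (fun i : Fin m => (Pi.single i 1 : Fin m → ℤ)))).submodule_iSup_eq_top]
          trivial
        induction hp using Submodule.iSup_induction' with
        | zero => rw [TensorProduct.zero_tmul, map_zero]; exact AddSubmonoid.zero_mem _
        | add p q _ _ hp hq =>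
          rw [TensorProduct.add_tmul, map_add]; exact AddSubmonoid.add_mem _ hp hq
        | mem α p hp =>
          refine AddSubmonoid.subset_closure ⟨α + deg a, ?_⟩
          intro b
          by_cases hab : a = b
          · subst hab
            rw [DirectSum.of_eq_same, add_sub_cancel_right, tensorGrade_eq_span]
            exact Submodule.subset_span ⟨p, hp, x, rfl⟩
          · rw [DirectSum.of_eq_of_ne _ _ _ (Ne.symm hab)]
            exact Submodule.zero_mem _

/-- The homogenization of a `P`-graded chain complex with respect to a morphism of posets
`deg : P → ℤ^m`. -/
noncomputable def homogenize [Fintype P] (F : PGradedComplex.{u, v, w} k P)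
    (deg : P →o (Fin m → ℤ)) : MultigradedComplex.{u, max u v w} k m where
  X n := F.HomX m n
  grade := F.homGrade deg
  isInternal := F.homGrade_isInternal deg
  smul_mem n α β p hp x hx a := by
    rw [DirectSum.smul_apply]
    exact smul_mem_tensorGrade hp (hx a) (by abel)
  d := F.homD deg
  d_comp_d := F.homD_homD deg
  d_mem := F.homD_mem deg

end PGradedComplex

/-! ## The conic chain complex

The dimension `d(a) = dim Δ(P_{≤a})` of an element `a` is `Order.height a`. -/

section Conic

variable (P : Type w) [PartialOrder P]

/-- The subset `P^{n-1} = {a ∈ P | d(a) ≤ n - 1}`; its order complex is the conic `(n-1)`-skeleton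
`Δ^{n-1}` of `Δ(P)`. -/
def conicSkeleton (n : ℕ) : Set P := {a | Order.height a < n}

variable {P}

lemma Iic_subset_conicSkeleton {a : P} {n : ℕ} (h : Order.height a = n) :
    Set.Iic a ⊆ conicSkeleton P (n + 1) := fun x hx => by
  have h1 : Order.height x ≤ n := h ▸ Order.height_mono hx
  exact lt_of_le_of_lt h1 (by exact_mod_cast Nat.lt_succ_self n)

lemma Iio_subset_conicSkeleton {a : P} {n : ℕ} (h : Order.height a = n) :
    Set.Iio a ⊆ conicSkeleton P n := fun x hx => by
  have hx' : Order.height x ≤ Order.height a := Order.height_mono (le_of_lt hx)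
  have h1 : Order.height x < Order.height a :=
    Order.height_strictMono hx (lt_of_le_of_lt hx' (h ▸ ENat.natCast_lt_top n))
  rw [h] at h1
  exact h1

lemma le_height_head {n : ℕ} (s : OrderFace P (n + 1)) : (n : ℕ∞) ≤ Order.height (s.1 0) := by
  let p : LTSeries P := ⟨n, fun i => s.1 i.rev, fun i => s.2 (by
    rw [Fin.rev_lt_rev]; exact Fin.castSucc_lt_succ)⟩
  have h := Order.length_le_height (p := p) (x := s.1 0)
    (s.2.antitone (Fin.zero_le _))
  exact h

variable (k : Type u) [CommRing k]

lemma chainsIn_conicSkeleton (n : ℕ) : chainsIn k (conicSkeleton P n) (n + 1) = ⊥ := by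
  rw [eq_bot_iff, chainsIn, Finsupp.supported_eq_span_single, Submodule.span_le]
  rintro _ ⟨s, hs, rfl⟩
  exact absurd (lt_of_lt_of_le (hs 0) (le_height_head s)) (lt_irrefl _)

lemma relBoundaries_conicSkeleton (n : ℕ) :
    relBoundaries k (conicSkeleton P (n + 1)) (conicSkeleton P n) n = ⊥ := by
  rw [relBoundaries, chainsIn_conicSkeleton, chainsIn_conicSkeleton]
  simp

/-- The part of a chain supported on the faces with largest vertex `a`. -/
noncomputable def headPart (n : ℕ) (a : P) : Chain k P (n + 1) →ₗ[k] Chain k P (n + 1) :=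
  open scoped Classical in
  Finsupp.linearCombination k fun s => if s.1 0 = a then Finsupp.single s (1 : k) else 0

lemma headPart_single_self {n : ℕ} (s : OrderFace P (n + 1)) (c : k) :
    headPart k n (s.1 0) (Finsupp.single s c) = Finsupp.single s c := by
  simp [headPart, Finsupp.linearCombination_single]

lemma headPart_single_of_ne {n : ℕ} {a : P} {s : OrderFace P (n + 1)} (h : s.1 0 ≠ a) (c : k) :
    headPart k n a (Finsupp.single s c) = 0 := by
  simp [headPart, Finsupp.linearCombination_single, h]

lemma boundary_headPart_eq {n : ℕ} {a : P} (ha : Order.height a = (n + 1 : ℕ))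
    {z : Chain k P (n + 2)} (hz : z ∈ chainsIn k (conicSkeleton P (n + 2)) (n + 2)) :
    headPart k n a (boundary k (n + 1) (headPart k (n + 1) a z)) =
      headPart k n a (boundary k (n + 1) z) := by
  have hle : chainsIn k (conicSkeleton P (n + 2)) (n + 2) ≤ LinearMap.ker
      (headPart k n a ∘ₗ boundary k (n + 1) ∘ₗ headPart k (n + 1) a -
        headPart k n a ∘ₗ boundary k (n + 1)) := by
    rw [chainsIn, Finsupp.supported_eq_span_single, Submodule.span_le]
    rintro _ ⟨s, hs, rfl⟩
    change _ - _ = (0 : Chain k P (n + 1))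
    simp only [LinearMap.comp_apply]
    by_cases h : s.1 0 = a
    · subst h
      rw [headPart_single_self, sub_self]
    · rw [headPart_single_of_ne k h, map_zero, map_zero, zero_sub, neg_eq_zero, boundary_single,
        map_sum]
      refine Finset.sum_eq_zero fun i _ => headPart_single_of_ne k ?_ _
      intro hi
      by_cases hi0 : i = 0
      · subst hi0
        have h1 : Order.height (s.1 0) < ((n + 2 : ℕ) : ℕ∞) := hs 0
        have h2 : a < s.1 0 := by
          rw [← hi]
          exact s.2 (show (0 : Fin (n + 2)) < (0 : Fin (n + 2)).succAbove 0 by simp)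
        have h3 := Order.height_add_one_le h2
        rw [ha] at h3
        exact absurd (lt_of_le_of_lt h3 h1) (by push_cast; exact lt_irrefl _)
      · apply h
        rw [← hi]
        change s.1 0 = s.1 (i.succAbove 0)
        rw [Fin.succAbove_ne_zero_zero hi0]
  exact sub_eq_zero.1 (hle hz)

lemma headPart_mem_Iic {n : ℕ} (a : P) (z : Chain k P (n + 1)) :
    headPart k n a z ∈ chainsIn k (Set.Iic a) (n + 1) := by
  induction z using Finsupp.induction_linear with
  | zero => rw [map_zero]; exact Submodule.zero_mem _
  | add x y hx hy => rw [map_add]; exact Submodule.add_mem _ hx hy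
  | single s c =>
    by_cases h : s.1 0 = a
    · subst h
      rw [headPart_single_self]
      exact Finsupp.single_mem_supported k _ fun i => s.2.antitone (Fin.zero_le i)
    · rw [headPart_single_of_ne k h]
      exact Submodule.zero_mem _

lemma mem_Iio_of_headPart_eq_zero {n : ℕ} {a : P} {z : Chain k P (n + 1)}
    (hz : z ∈ chainsIn k (Set.Iic a) (n + 1)) (h0 : headPart k n a z = 0) :
    z ∈ chainsIn k (Set.Iio a) (n + 1) := by
  have hle : chainsIn k (Set.Iic a) (n + 1) ≤
      (chainsIn k (Set.Iio a) (n + 1)).comap (LinearMap.id - headPart k n a) := by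
    rw [chainsIn, Finsupp.supported_eq_span_single, Submodule.span_le]
    rintro _ ⟨s, hs, rfl⟩
    change _ - _ ∈ chainsIn k (Set.Iio a) (n + 1)
    rw [LinearMap.id_apply]
    by_cases h : s.1 0 = a
    · subst h
      rw [headPart_single_self, sub_self]
      exact Submodule.zero_mem _
    · rw [headPart_single_of_ne k h, sub_zero]
      exact Finsupp.single_mem_supported k _ fun i =>
        lt_of_le_of_lt (s.2.antitone (Fin.zero_le i)) (lt_of_le_of_ne (hs 0) h)
  have h := hle hz
  change z - headPart k n a z ∈ chainsIn k (Set.Iio a) (n + 1) at h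
  rwa [h0, sub_zero] at h

lemma headPart_eq_zero_of_mem {n : ℕ} {a : P} {S : Set P} (ha : a ∉ S) {z : Chain k P (n + 1)}
    (hz : z ∈ chainsIn k S (n + 1)) : headPart k n a z = 0 := by
  have hle : chainsIn k S (n + 1) ≤ LinearMap.ker (headPart k n a) := by
    rw [chainsIn, Finsupp.supported_eq_span_single, Submodule.span_le]
    rintro _ ⟨s, hs, rfl⟩
    exact headPart_single_of_ne k (fun h => ha (by rw [← h]; exact hs 0)) _
  exact hle hz

/-- The part with largest vertex `a` of a relative `n`-cycle of the pair `(Δ^n, Δ^{n-1})` is a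
relative cycle of the pair `(Δ_{≤a}, Δ_{<a})`. -/
lemma headPart_mem {n : ℕ} {a : P} (ha : Order.height a = n) {z : Chain k P (n + 1)}
    (hz : z ∈ relCycles k (conicSkeleton P (n + 1)) (conicSkeleton P n) n) :
    headPart k n a z ∈ relCycles k (Set.Iic a) (Set.Iio a) n := by
  refine ⟨headPart_mem_Iic k a z, ?_⟩
  cases n with
  | zero => exact (Finsupp.mem_supported k _).2 fun s _ i => Fin.elim0 i
  | succ n =>
    refine mem_Iio_of_headPart_eq_zero k (boundary_mem k (headPart_mem_Iic k a z)) ?_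
    rw [boundary_headPart_eq k ha hz.1]
    refine headPart_eq_zero_of_mem k (S := conicSkeleton P (n + 1)) ?_ hz.2
    change ¬ Order.height a < ((n + 1 : ℕ) : ℕ∞)
    rw [ha]
    exact lt_irrefl _

lemma headPart_of_mem {n : ℕ} {a : P} (ha : Order.height a = n) {z : Chain k P (n + 1)}
    (hz : z ∈ chainsIn k (Set.Iic a) (n + 1)) : headPart k n a z = z := by
  have hle : chainsIn k (Set.Iic a) (n + 1) ≤ LinearMap.ker (headPart k n a - LinearMap.id) := by
    rw [chainsIn, Finsupp.supported_eq_span_single, Submodule.span_le]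
    rintro _ ⟨s, hs, rfl⟩
    have h : s.1 0 = a := by
      by_contra h
      have h1 : s.1 0 ∈ conicSkeleton P n :=
        Iio_subset_conicSkeleton ha (lt_of_le_of_ne (hs 0) h)
      exact absurd (lt_of_lt_of_le h1 (le_height_head s)) (lt_irrefl _)
    subst h
    change _ - _ = (0 : Chain k P (n + 1))
    rw [headPart_single_self, LinearMap.id_apply, sub_self]
  exact sub_eq_zero.1 (hle hz)

lemma headPart_of_mem_ne {n : ℕ} {a b : P} (ha : Order.height a = n) (hb : Order.height b = n)
    (hab : a ≠ b) {z : Chain k P (n + 1)} (hz : z ∈ chainsIn k (Set.Iic a) (n + 1)) :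
    headPart k n b z = 0 := by
  refine headPart_eq_zero_of_mem k (S := Set.Iic a) (fun h => ?_) hz
  have h1 : b ∈ conicSkeleton P n := Iio_subset_conicSkeleton ha (lt_of_le_of_ne h hab.symm)
  change Order.height b < (n : ℕ∞) at h1
  rw [hb] at h1
  exact lt_irrefl _ h1

variable (P)

/-- The module `C_n(P, k) = H_n(Δ^n, Δ^{n-1}; k)` of the conic chain complex. -/
abbrev ConicX (n : ℕ) : Type (max u w) :=
  RelHomology k (conicSkeleton P (n + 1)) (conicSkeleton P n) n

variable {P}

open scoped Classical in
/-- The component of `C_n(P, k)` at `a`: the image of `H_n(Δ_{≤a}, Δ_{<a}; k)` if `d(a) = n`, and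
zero otherwise. -/
noncomputable def conicComp (n : ℕ) (a : P) : Submodule k (ConicX P k n) :=
  if h : Order.height a = n then
    LinearMap.range (relMap k (Iic_subset_conicSkeleton h) (Iio_subset_conicSkeleton h) n)
  else ⊥

lemma mem_conicComp {n : ℕ} {a : P} (ha : Order.height a = n) {x : ConicX P k n} :
    x ∈ conicComp k n a ↔ ∃ z, ∃ hz : z ∈ relCycles k (conicSkeleton P (n + 1)) (conicSkeleton P n) n,
      z ∈ relCycles k (Set.Iic a) (Set.Iio a) n ∧ relMk k _ _ n ⟨z, hz⟩ = x := by
  rw [conicComp, dif_pos ha]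
  constructor
  · rintro ⟨y, rfl⟩
    obtain ⟨⟨z, hz⟩, rfl⟩ := relMk_surjective k _ _ _ y
    exact ⟨z, _, hz, rfl⟩
  · rintro ⟨z, hz, hz', rfl⟩
    exact ⟨relMk k _ _ n ⟨z, hz'⟩, rfl⟩

/-- The map induced on `C_n(P, k)` by `headPart` for `d(a) = n`. -/
noncomputable def conicProj {n : ℕ} {a : P} (ha : Order.height a = n) :
    ConicX P k n →ₗ[k] ConicX P k n :=
  relLift k
    ((headPart k n a).restrict fun z hz =>
      (⟨chainsIn_mono k (Iic_subset_conicSkeleton ha) _ (headPart_mem k ha hz).1,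
        chainsIn_mono k (Iio_subset_conicSkeleton ha) _ (headPart_mem k ha hz).2⟩ :
        headPart k n a z ∈ relCycles k (conicSkeleton P (n + 1)) (conicSkeleton P n) n))
    (by
      rintro ⟨z, hz⟩ hzb
      rw [relBoundaries_conicSkeleton, Submodule.mem_bot] at hzb
      change z = 0 at hzb
      subst hzb
      change headPart k n a 0 ∈ relBoundaries k (conicSkeleton P (n + 1)) (conicSkeleton P n) n
      rw [map_zero]
      exact Submodule.zero_mem _)

lemma sum_headPart {n : ℕ} (z : Chain k P (n + 1)) :
    ∃ s : Finset P, (∀ a ∈ s, ∃ t ∈ z.support, t.1 0 = a) ∧ ∑ a ∈ s, headPart k n a z = z := by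
  classical
  refine ⟨z.support.image fun t => t.1 0, fun a ha => by simpa using ha, ?_⟩
  conv_rhs => rw [← Finsupp.sum_single z]
  have h : ∀ a, headPart k n a z = ∑ t ∈ z.support, headPart k n a (Finsupp.single t (z t)) := by
    intro a
    conv_lhs => rw [← Finsupp.sum_single z]
    rw [Finsupp.sum, map_sum]
  simp only [h, Finsupp.sum]
  rw [Finset.sum_comm]
  refine Finset.sum_congr rfl fun t ht => ?_
  rw [Finset.sum_eq_single (t.1 0), headPart_single_self]
  · intro b _ hb
    exact headPart_single_of_ne k (Ne.symm hb) _
  · intro h0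
    exact absurd (Finset.mem_image_of_mem _ ht) h0

lemma mk_mem_closure_conicComp {n : ℕ} {z : Chain k P (n + 1)} {S : Set P}
    (hz : z ∈ relCycles k (conicSkeleton P (n + 1)) (conicSkeleton P n) n)
    (hzS : z ∈ chainsIn k S (n + 1)) :
    (relMk k _ _ n ⟨z, hz⟩ : ConicX P k n) ∈
      AddSubmonoid.closure {y | ∃ a ∈ S, y ∈ conicComp k n a} := by
  obtain ⟨s, hs, hsum⟩ := sum_headPart k z
  have hht : ∀ a ∈ s, Order.height a = n := by
    intro a ha
    obtain ⟨t, ht, rfl⟩ := hs a ha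
    have h1 : Order.height (t.1 0) < ((n + 1 : ℕ) : ℕ∞) :=
      (Finsupp.mem_supported k z).1 hz.1 ht 0
    push_cast at h1
    exact le_antisymm (Order.le_of_lt_add_one h1) (le_height_head t)
  have hmem : ∀ a ∈ s, headPart k n a z ∈
      relCycles k (conicSkeleton P (n + 1)) (conicSkeleton P n) n := fun a ha =>
    ⟨chainsIn_mono k (Iic_subset_conicSkeleton (hht a ha)) _ (headPart_mem k (hht a ha) hz).1,
      chainsIn_mono k (Iio_subset_conicSkeleton (hht a ha)) _ (headPart_mem k (hht a ha) hz).2⟩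
  have hz' : (⟨z, hz⟩ : relCycles k (conicSkeleton P (n + 1)) (conicSkeleton P n) n) =
      ∑ a ∈ s.attach, ⟨headPart k n (a : P) z, hmem a a.2⟩ := by
    apply Subtype.ext
    rw [AddSubmonoidClass.coe_finsetSum]
    exact hsum.symm.trans (Finset.sum_attach s fun a => headPart k n a z).symm
  rw [hz', map_sum]
  refine AddSubmonoid.sum_mem _ fun a _ => AddSubmonoid.subset_closure ⟨a, ?_, ?_⟩
  · obtain ⟨t, ht, hta⟩ := hs a a.2
    rw [← hta]
    exact (Finsupp.mem_supported k z).1 hzS ht 0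
  · exact (mem_conicComp k (hht a a.2)).2 ⟨_, _, headPart_mem k (hht a a.2) hz, rfl⟩

open scoped Classical in
lemma conicComp_isInternal (n : ℕ) : DirectSum.IsInternal (conicComp (P := P) k n) := by
  refine isInternal_of_proj _
    (fun a => if h : Order.height a = n then (conicProj k h).toAddMonoidHom else 0) ?_ ?_ ?_
  · intro a x hx
    by_cases ha : Order.height a = n
    · obtain ⟨z, hz, hz', rfl⟩ := (mem_conicComp k ha).1 hx
      rw [dif_pos ha]
      refine congrArg (relMk k _ _ _) (Subtype.ext ?_)
      exact headPart_of_mem k ha hz'.1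
    · rw [conicComp, dif_neg ha, Submodule.mem_bot] at hx
      rw [hx, map_zero]
  · intro a b hab x hx
    by_cases ha : Order.height a = n
    · by_cases hb : Order.height b = n
      · obtain ⟨z, hz, hz', rfl⟩ := (mem_conicComp k ha).1 hx
        rw [dif_pos hb]
        refine (congrArg (relMk k _ _ _) (Subtype.ext ?_)).trans
          (map_zero _)
        exact headPart_of_mem_ne k ha hb hab hz'.1
      · rw [dif_neg hb]
        rfl
    · rw [conicComp, dif_neg ha, Submodule.mem_bot] at hx
      rw [hx, map_zero]
  · intro x
    obtain ⟨⟨z, hz⟩, rfl⟩ := relMk_surjective k _ _ _ x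
    refine AddSubmonoid.closure_mono ?_ (mk_mem_closure_conicComp k hz (S := Set.univ)
      ((Finsupp.mem_supported k z).2 fun _ _ _ => trivial))
    rintro y ⟨a, -, hy⟩
    exact ⟨a, hy⟩

lemma relConnecting_mk {S T U : Set P} {n : ℕ} {z : Chain k P (n + 2)}
    (hz : z ∈ relCycles k S T (n + 1)) (hz' : boundary k (n + 1) z ∈ relCycles k T U n) :
    relConnecting k S T U n (relMk k S T (n + 1) ⟨z, hz⟩) =
      relMk k T U n ⟨boundary k (n + 1) z, hz'⟩ := rfl

lemma boundary_mem_relCycles {S T U : Set P} {n : ℕ} {z : Chain k P (n + 2)}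
    (hz : z ∈ relCycles k S T (n + 1)) : boundary k (n + 1) z ∈ relCycles k T U n :=
  (relCyclesBoundary k S T U n ⟨z, hz⟩).2

lemma relConnecting_relConnecting {S T U V : Set P} {n : ℕ} (x : RelHomology k S T (n + 2)) :
    relConnecting k T U V n (relConnecting k S T U (n + 1) x) = 0 := by
  obtain ⟨⟨z, hz⟩, rfl⟩ := relMk_surjective k _ _ _ x
  rw [relConnecting_mk k hz (boundary_mem_relCycles k hz),
    relConnecting_mk k _ (boundary_mem_relCycles k (boundary_mem_relCycles k hz))]
  refine (congrArg (relMk k _ _ _) (Subtype.ext ?_)).trans (map_zero _)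
  exact boundary_boundary k z

/-- The differential `H_{n+1}(Δ^{n+1}, Δ^n) → H_n(Δ^n, Δ^{n-1})` of the conic chain complex. -/
noncomputable def conicD (n : ℕ) : ConicX P k (n + 1) →ₗ[k] ConicX P k n :=
  relConnecting k (conicSkeleton P (n + 1 + 1)) (conicSkeleton P (n + 1)) (conicSkeleton P n) n

lemma conicD_conicD (n : ℕ) (x : ConicX P k (n + 1 + 1)) : conicD k n (conicD k (n + 1) x) = 0 :=
  relConnecting_relConnecting k (S := conicSkeleton P (n + 1 + 1 + 1))
    (T := conicSkeleton P (n + 1 + 1)) (U := conicSkeleton P (n + 1)) (V := conicSkeleton P n) x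

lemma conic_triangular {n : ℕ} {a b : P} (hb : ¬ b ≤ a) {x : ConicX P k (n + 1)}
    (hx : x ∈ conicComp k (n + 1) a) :
    internalProj (conicComp_isInternal k n) b (conicD k n x) = 0 := by
  by_cases ha : Order.height a = (n + 1 : ℕ)
  · obtain ⟨z, hz, hz', rfl⟩ := (mem_conicComp k ha).1 hx
    rw [conicD, relConnecting_mk k hz (boundary_mem_relCycles k hz)]
    have h := mk_mem_closure_conicComp k (boundary_mem_relCycles k hz) (S := Set.Iio a) hz'.2
    generalize (relMk k _ _ n ⟨boundary k (n + 1) z, boundary_mem_relCycles k hz⟩ :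
      ConicX P k n) = y at h
    induction h using AddSubmonoid.closure_induction with
    | mem y hy =>
      obtain ⟨c, hc, hy⟩ := hy
      exact internalProj_of_ne _ (fun h : c = b => hb (h ▸ le_of_lt hc)) hy
    | zero => rw [map_zero]
    | add y y' _ _ hy hy' => rw [map_add, hy, hy', add_zero]
  · rw [conicComp, dif_neg ha, Submodule.mem_bot] at hx
    rw [hx, map_zero, map_zero]

variable (P)

/-- The conic chain complex of `P` over `k`, with its natural `P`-grading. -/
noncomputable def conicComplex : PGradedComplex.{u, max u w, w} k P where
  X := ConicX P k
  d := conicD k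
  d_comp_d := conicD_conicD k
  comp := conicComp k
  isInternal := conicComp_isInternal k
  d_triangular _ _ _ hba _ hx := conic_triangular k hba hx

end Conic

end ConicRes

/-! Setting all variables to 1 in a minimal resolution leaves an augmented complex of vector spaces
filtered by degree; the strand of degree `α` is spanned by the basis elements of degree at most `α`.
Conversely, such a filtered complex homogenizes to a minimal resolution once these subcomplexes are
exact whenever `x^α ∈ I` and no entry of the differential joins equal degrees
(`homogenize_isMinimalFreeResolution`). The task is to choose the bases so that the basis elements,
called cells, form a poset whose conic complex is this filtered complex.

The bases are chosen inductively so that the boundary of each cell is a circuit, that is, has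
minimal support among the nonzero cycles of its degree. Circuits suffice because they span
(`le_span_circuits`, `exists_circuit_generators`, `nonempty_circuitComplex`). A matroid argument
(`exists_spanning_of_circuit`) then attaches to a cell of positive dimension a set `D` of cells one
dimension lower. It contains the support of the boundary, the boundary is the only relation on it up
to scalars, and it has the same image under the differential as all cells of admissible degree.
Below a cell of dimension `n` are placed the cells of `D` in dimension `n - 1` and all cells of no
larger degree in dimension at most `n - 2`. With this order every closed cell is acyclic
(`exists_isCellOrder`).

Acyclic closed cells make the order complex behave like a barycentric subdivision. Coning off
boundaries gives a chain map `subdiv`, and acyclic carriers show that a simplicial cycle in a lower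
set is homologous there to a subdivided cellular cycle (`exists_carried_retraction`). Hence the
order complexes of the sets `Set.Iio a` are homology spheres (`isHCWPoset`), and the cellular
complex is the conic one (`conicEquiv`, `conicD_toConic`). Uniqueness of the minimal resolution is
graded Nakayama (`bijective_of_congruent_id`). -/

namespace ConicRes

/-! ## Circuits -/

section Circuits

variable (k : Type u) [Field k]

/-- The coordinate subspace of vectors supported in `A`. -/
def coordSub {ι : Type*} (A : Set ι) : Submodule k (ι → k) where
  carrier := {v | ∀ i, i ∉ A → v i = 0}
  zero_mem' _ _ := rfl
  add_mem' hv hw i hi := by simp [hv i hi, hw i hi]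
  smul_mem' c v hv i hi := by simp [hv i hi]

variable {k}

lemma coordSub_mono {ι : Type*} {A A' : Set ι} (h : A ⊆ A') : coordSub k A ≤ coordSub k A' :=
  fun _ hv i hi => hv i fun hA => hi (h hA)

lemma single_mem_coordSub {ι : Type*} [DecidableEq ι] {A : Set ι} {i : ι} (hi : i ∈ A) (c : k) :
    (Pi.single i c : ι → k) ∈ coordSub k A := fun j hj => by
  rw [Pi.single_eq_of_ne]
  rintro rfl
  exact hj hi

/-- `c` is a nonzero vector of minimal support in `Z`. -/
def IsCircuitIn {ι : Type*} (Z : Submodule k (ι → k)) (c : ι → k) : Prop :=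
  c ∈ Z ∧ c ≠ 0 ∧ ∀ z ∈ Z, (∀ i, c i = 0 → z i = 0) → ∃ t : k, z = t • c

/-- If `z` is not a circuit, some vector of `Z` supported in the support of `z` is not proportional
to it. Cancelling coordinates with this vector writes `z` as a combination of two vectors of
strictly smaller support, so induction on the size of the support applies. -/
lemma le_span_circuits {ι : Type*} [Fintype ι] (Z : Submodule k (ι → k)) :
    Z ≤ Submodule.span k {c | IsCircuitIn Z c} := by
  classical
  suffices h : ∀ (n : ℕ) (z : ι → k), z ∈ Z → (Finset.univ.filter fun i => z i ≠ 0).card = n →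
      z ∈ Submodule.span k {c | IsCircuitIn Z c} from fun z hz => h _ z hz rfl
  intro n
  induction n using Nat.strong_induction_on with
  | _ n ih =>
  intro z hz hn
  by_cases hz0 : z = 0
  · rw [hz0]; exact Submodule.zero_mem _
  by_cases hc : IsCircuitIn Z z
  · exact Submodule.subset_span hc
  have key : ∀ w ∈ Z, (∀ i, z i = 0 → w i = 0) → (∃ i, z i ≠ 0 ∧ w i = 0) →
      w ∈ Submodule.span k {c | IsCircuitIn Z c} := by
    rintro w hw hzw ⟨i, hi, hwi⟩
    refine ih _ ?_ w hw rfl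
    rw [← hn]
    refine Finset.card_lt_card (Finset.ssubset_iff_subset_ne.2 ⟨fun j hj => ?_, fun h => ?_⟩)
    · simp only [Finset.mem_filter, Finset.mem_univ, true_and] at hj ⊢
      exact fun h0 => hj (hzw j h0)
    · have : i ∈ Finset.univ.filter fun i => w i ≠ 0 := by rw [h]; simp [hi]
      simp [hwi] at this
  obtain ⟨w, hw, hzw, hspan⟩ : ∃ w ∈ Z, (∀ i, z i = 0 → w i = 0) ∧ ∀ t : k, w ≠ t • z := by
    by_contra! hcon
    exact hc ⟨hz, hz0, fun w hw hzw => hcon w hw hzw⟩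
  obtain ⟨i, hi⟩ : ∃ i, z i ≠ 0 := Function.ne_iff.1 hz0
  set u := w - (w i / z i) • z with hu
  have huZ : u ∈ Z := Z.sub_mem hw (Z.smul_mem _ hz)
  have hzu : ∀ j, z j = 0 → u j = 0 := fun j hj => by simp [hu, hj, hzw j hj]
  have hu1 := key u huZ hzu ⟨i, hi, by simp [hu, hi]⟩
  obtain ⟨j, hj⟩ : ∃ j, u j ≠ 0 :=
    Function.ne_iff.1 fun h => hspan _ (sub_eq_zero.1 (hu ▸ h))
  have hzj : z j ≠ 0 := fun h => hj (hzu j h)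
  have hw1 := key (z - (z j / u j) • u) (Z.sub_mem hz (Z.smul_mem _ huZ))
    (fun l hl => by simp [hl, hzu l hl]) ⟨j, hzj, by simp [hj]⟩
  have := Submodule.add_mem _ hw1 (Submodule.smul_mem _ (z j / u j) hu1)
  rwa [sub_add_cancel] at this

/-- Minimal generators, consisting of circuits, of a finite filtered family of subspaces. -/
theorem exists_circuit_generators {Λ : Type w} [PartialOrder Λ] [Finite Λ] {ι : Type v} [Fintype ι]
    (Z : Λ →o Submodule k (ι → k)) :
    ∃ (r : ℕ) (deg : Fin r → Λ) (δ : (Fin r → k) →ₗ[k] (ι → k)),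
      (∀ i, IsCircuitIn (Z (deg i)) (δ (Pi.single i 1))) ∧
      (∀ α, Z α ≤ (coordSub k {i | deg i ≤ α}).map δ) ∧
      ∀ v, δ v = 0 → ∀ i, v ∈ coordSub k {j | deg j ≤ deg i} → v i = 0 := by
  classical
  -- `N α` is what the smaller degrees already generate. The new generators in degree `α` are
  -- circuits of `Z α` forming a basis modulo `N α`.
  let N : Λ → Submodule k (ι → k) := fun α => ⨆ β, ⨆ _ : β < α, Z β
  have hN : ∀ {α β}, β < α → Z β ≤ N α := fun h => le_iSup₂_of_le _ h le_rfl
  have hex : ∀ α, ∃ b ⊆ {c | IsCircuitIn (Z α) c},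
      (N α).mkQ '' {c | IsCircuitIn (Z α) c} ⊆ Submodule.span k ((N α).mkQ '' b) ∧
      LinearIndepOn k (N α).mkQ b := fun α => by
    obtain ⟨b, h1, -, h2, h3⟩ := exists_linearIndepOn_extension (K := k) (v := (N α).mkQ)
      (linearIndepOn_empty k _) (Set.empty_subset {c | IsCircuitIn (Z α) c})
    exact ⟨b, h1, h2, h3⟩
  choose b hb hspan hli using hex
  have hfin : ∀ α, Finite (b α) := fun α => (hli α).linearIndependent.finite
  obtain ⟨r, ⟨e⟩⟩ := Finite.exists_equiv_fin (Σ α, b α)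
  let c : Fin r → ι → k := fun i => (e.symm i).2.1
  let deg : Fin r → Λ := fun i => (e.symm i).1
  let δ : (Fin r → k) →ₗ[k] (ι → k) := Fintype.linearCombination k c
  have hδ : ∀ i, δ (Pi.single i 1) = c i := fun i => by
    simp [δ, Fintype.linearCombination_apply_single]
  have hc : ∀ i, IsCircuitIn (Z (deg i)) (c i) := fun i => hb _ (e.symm i).2.2
  refine ⟨r, deg, δ, fun i => by rw [hδ]; exact hc i, fun α => ?_, fun v hv i hvi => ?_⟩
  · induction α using WellFoundedLT.induction with
    | _ α ih =>
    have hNle : N α ≤ (coordSub k {i | deg i ≤ α}).map δ :=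
      iSup₂_le fun β hβ => (ih β hβ).trans
        (Submodule.map_mono (coordSub_mono fun i hi => le_trans hi hβ.le))
    have hble : Submodule.span k (b α) ≤ (coordSub k {i | deg i ≤ α}).map δ := by
      rw [Submodule.span_le]
      intro x hx
      refine ⟨Pi.single (e ⟨α, x, hx⟩) 1, single_mem_coordSub ?_ _, ?_⟩
      · simp [deg]
      · rw [hδ]
        change ((e.symm (e ⟨α, x, hx⟩)).2 : ι → k) = x
        rw [Equiv.symm_apply_apply]
    intro z hz
    have h1 : (N α).mkQ z ∈ Submodule.span k ((N α).mkQ '' b α) := by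
      have h2 := Submodule.mem_map_of_mem (f := (N α).mkQ) (le_span_circuits (Z α) hz)
      rw [Submodule.map_span] at h2
      exact Submodule.span_le.2 (hspan α) h2
    rw [← Submodule.map_span] at h1
    obtain ⟨z', hz', hzz'⟩ := h1
    have h3 : z - z' ∈ N α := by
      rw [← Submodule.ker_mkQ (N α), LinearMap.mem_ker, map_sub, hzz', sub_self]
    have := Submodule.add_mem _ (hNle h3) (hble hz')
    rwa [sub_add_cancel] at this
  -- Minimality: modulo `N (deg i)`, a relation among generators of degree at most `deg i` involves
  -- only those of degree exactly `deg i`, and these are independent there.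
  · let f : {j // deg j = deg i} → b (deg i) := fun j => ⟨c j, by
      have h : c j ∈ b (deg j) := (e.symm j.1).2.2
      rwa [j.2] at h⟩
    have hf : Function.Injective f := fun j j' h => by
      apply Subtype.ext
      apply e.symm.injective
      refine Sigma.subtype_ext (j.2.trans j'.2.symm) ?_
      exact congrArg Subtype.val h
    have hli' := (hli (deg i)).linearIndependent.comp f hf
    have hsum : ∑ j : {j // deg j = deg i}, v j • (N (deg i)).mkQ (c j) = 0 := by
      have h1 : (N (deg i)).mkQ (δ v) = 0 := by rw [hv, map_zero]
      rw [Fintype.linearCombination_apply, map_sum] at h1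
      rw [← h1, ← Finset.sum_subtype (Finset.univ.filter fun j => deg j = deg i) (by simp)
        fun j => v j • (N (deg i)).mkQ (c j), Finset.sum_filter]
      refine Finset.sum_congr rfl fun j _ => ?_
      split_ifs with hj
      · rw [map_smul]
      · by_cases hle : deg j ≤ deg i
        · have hm : c j ∈ N (deg i) := hN (lt_of_le_of_ne hle hj) (hc j).1
          rw [map_smul, Submodule.mkQ_apply, (Submodule.Quotient.mk_eq_zero _).2 hm, smul_zero]
        · rw [hvi j hle, zero_smul, map_zero]
    exact Fintype.linearIndependent_iff.1 hli' (fun j => v j) hsum ⟨i, rfl⟩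

/-- A circuit `c` of `ker δ` supported in `A` is the only relation, up to scalars, on some set
`D ⊆ A` that contains its support and spans the same image as `A`. -/
theorem exists_spanning_of_circuit {ι : Type v} [Fintype ι] {W : Type w} [AddCommGroup W]
    [Module k W] (δ : (ι → k) →ₗ[k] W) (A : Set ι) {c : ι → k}
    (hc : IsCircuitIn (LinearMap.ker δ ⊓ coordSub k A) c) :
    ∃ D ⊆ A, c ∈ coordSub k D ∧ (∀ z ∈ coordSub k D, δ z = 0 → ∃ t : k, z = t • c) ∧
      (coordSub k A).map δ ≤ (coordSub k D).map δ := by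
  classical
  obtain ⟨⟨hck, hcA⟩, hc0, hmin⟩ := hc
  obtain ⟨e, he⟩ : ∃ e, c e ≠ 0 := Function.ne_iff.1 hc0
  have hsA : ∀ i, c i ≠ 0 → i ∈ A := fun i hi => by
    by_contra h
    exact hi (hcA i h)
  -- Minimality of the support makes the columns of `δ` indexed by the support of `c` without `e`
  -- independent. They extend to a maximal independent subset `b` of `A`, and `D` will be `b` with
  -- `e` put back: one extra element creates one relation.
  let s : Set ι := {i | c i ≠ 0 ∧ i ≠ e}
  have hδ : ∀ v, δ v = ∑ i, v i • δ (Pi.single i 1) := fun v => by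
    conv_lhs => rw [pi_eq_sum_univ' v]
    simp only [map_sum, map_smul]
  have hli : ∀ t : Set ι, LinearIndepOn k (fun i => δ (Pi.single i 1)) t ↔
      ∀ z ∈ coordSub k t, δ z = 0 → z = 0 := fun t => by
    have hlc : ∀ l : ι →₀ k, Finsupp.linearCombination k (fun i => δ (Pi.single i 1)) l = δ l :=
      fun l => by
        rw [hδ, Finsupp.linearCombination_apply, Finsupp.sum_fintype]
        simp
    rw [linearIndepOn_iff]
    constructor
    · intro h z hz hz0
      have := h (Finsupp.equivFunOnFinite.symm z)
        ((Finsupp.mem_supported' _ _).2 fun i hi => hz i hi) (by rw [hlc]; exact hz0)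
      rw [← Finsupp.coe_equivFunOnFinite_symm z, this, Finsupp.coe_zero]
    · intro h l hl hl0
      exact DFunLike.coe_injective
        (h l (fun i hi => (Finsupp.mem_supported' _ _).1 hl i hi) (by rw [← hlc]; exact hl0))
  obtain ⟨b, hbA, hsb, hspan, hbli⟩ := exists_linearIndepOn_extension (K := k)
    (v := fun i => δ (Pi.single i 1)) (s := s) (t := A) ((hli s).2 fun z hz hz0 => by
      have hze : z e = 0 := hz e fun h => h.2 rfl
      obtain ⟨t, rfl⟩ := hmin z ⟨hz0, fun i hi => hz i fun h => hi (hsA i h.1)⟩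
        fun i hi => hz i fun h => h.1 hi
      have ht : t = 0 := by simpa [he] using hze
      rw [ht, zero_smul]) fun i hi => hsA i hi.1
  refine ⟨insert e b, Set.insert_subset (hsA e he) hbA, fun i hi => ?_, fun z hz hz0 => ?_, ?_⟩
  · by_contra h
    exact hi (Set.mem_insert_iff.2 (or_iff_not_imp_left.2 fun hie => hsb ⟨h, hie⟩))
  -- Subtracting the multiple of `c` that cancels the coordinate `e` leaves a relation on the
  -- independent set `b`.
  · refine ⟨z e / c e, sub_eq_zero.1 ((hli b).1 hbli _ (fun i hi => ?_) ?_)⟩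
    · by_cases hie : i = e
      · subst hie; simp [he]
      · have h1 : z i = 0 := hz i fun h => (Set.mem_insert_iff.1 h).elim hie hi
        have h2 : c i = 0 := by
          by_contra h
          exact hi (hsb ⟨h, hie⟩)
        simp [h1, h2]
    · rw [map_sub, map_smul, hz0, LinearMap.mem_ker.1 hck]; simp
  · rintro _ ⟨v, hv, rfl⟩
    rw [hδ]
    refine Submodule.sum_mem _ fun i _ => ?_
    by_cases hi : i ∈ A
    · refine Submodule.smul_mem _ _ (Submodule.span_le.2 ?_ (hspan ⟨i, hi, rfl⟩))
      rintro _ ⟨j, hj, rfl⟩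
      exact ⟨_, single_mem_coordSub (Set.mem_insert_of_mem e hj) 1, rfl⟩
    · rw [hv i hi, zero_smul]
      exact Submodule.zero_mem _

end Circuits

/-! ## Cones -/

section Cones

variable {P : Type w} [PartialOrder P] (k : Type u) [CommRing k]

variable (P) in
/-- The empty face. -/
def OrderFace.empty : OrderFace P 0 := ⟨Fin.elim0, fun i => i.elim0⟩

lemma OrderFace.eq_empty (s : OrderFace P 0) : s = OrderFace.empty P :=
  Subtype.ext (funext fun i => i.elim0)

/-- The face obtained by adding a new largest vertex. -/
def OrderFace.cons {n : ℕ} (a : P) (s : OrderFace P n) (h : ∀ i, s.1 i < a) :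
    OrderFace P (n + 1) :=
  ⟨Fin.cons a s.1, fun i j hij => by
    induction j using Fin.cases with
    | zero => exact absurd hij (Fin.not_lt_zero i)
    | succ j =>
      induction i using Fin.cases with
      | zero => simpa using h j
      | succ i => simpa using s.2 (Fin.succ_lt_succ_iff.1 hij)⟩

lemma OrderFace.face_cons_zero {n : ℕ} (a : P) (s : OrderFace P n) (h : ∀ i, s.1 i < a) :
    (s.cons a h).face 0 = s := by
  apply Subtype.ext
  funext j
  simp [OrderFace.face, OrderFace.cons]

lemma OrderFace.face_cons_succ {n : ℕ} (a : P) (s : OrderFace P (n + 1)) (h : ∀ i, s.1 i < a)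
    (i : Fin (n + 1)) :
    (s.cons a h).face i.succ = (s.face i).cons a fun j => h (i.succAbove j) := by
  apply Subtype.ext
  funext j
  induction j using Fin.cases with
  | zero => simp [OrderFace.face, OrderFace.cons]
  | succ j => simp [OrderFace.face, OrderFace.cons]

lemma OrderFace.cons_face_zero {n : ℕ} (s : OrderFace P (n + 1)) (h : ∀ i, (s.face 0).1 i < s.1 0) :
    (s.face 0).cons (s.1 0) h = s := by
  apply Subtype.ext
  funext j
  induction j using Fin.cases with
  | zero => simp [OrderFace.cons]
  | succ j => simp [OrderFace.face, OrderFace.cons]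

open scoped Classical in
/-- The cone with apex `a` over a chain; faces containing vertices outside `P_{<a}` are discarded. -/
noncomputable def cone (a : P) (n : ℕ) : Chain k P n →ₗ[k] Chain k P (n + 1) :=
  Finsupp.linearCombination k fun s =>
    if h : ∀ i, s.1 i < a then Finsupp.single (s.cons a h) (1 : k) else 0

variable {k}

lemma cone_single {a : P} {n : ℕ} {s : OrderFace P n} (h : ∀ i, s.1 i < a) (c : k) :
    cone k a n (Finsupp.single s c) = Finsupp.single (s.cons a h) c := by
  simp [cone, Finsupp.linearCombination_single, h]

lemma cone_single_of_not {a : P} {n : ℕ} {s : OrderFace P n} (h : ¬ ∀ i, s.1 i < a) (c : k) :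
    cone k a n (Finsupp.single s c) = 0 := by
  simp only [cone, Finsupp.linearCombination_single, dif_neg h, smul_zero]

lemma chainsIn_induction {S : Set P} {n : ℕ} {p : Submodule k (Chain k P n)}
    (h : ∀ s : OrderFace P n, (∀ i, s.1 i ∈ S) → Finsupp.single s (1 : k) ∈ p) :
    chainsIn k S n ≤ p := by
  rw [chainsIn, Finsupp.supported_eq_span_single, Submodule.span_le]
  rintro _ ⟨s, hs, rfl⟩
  exact h s hs

lemma single_mem_chainsIn {S : Set P} {n : ℕ} {s : OrderFace P n} (h : ∀ i, s.1 i ∈ S) (c : k) :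
    Finsupp.single s c ∈ chainsIn k S n :=
  Finsupp.single_mem_supported k _ h

lemma cone_mem_insert {S : Set P} (a : P) {n : ℕ} {z : Chain k P n} (hz : z ∈ chainsIn k S n) :
    cone k a n z ∈ chainsIn k (insert a S) (n + 1) := by
  suffices h : chainsIn k S n ≤ (chainsIn k (insert a S) (n + 1)).comap (cone k a n) from h hz
  refine chainsIn_induction fun s hs => ?_
  rw [Submodule.mem_comap]
  by_cases h : ∀ i, s.1 i < a
  · rw [cone_single h]
    refine single_mem_chainsIn (fun i => ?_) _
    induction i using Fin.cases with
    | zero => exact Set.mem_insert _ _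
    | succ i => simpa [OrderFace.cons] using Or.inr (hs i)
  · rw [cone_single_of_not h]
    exact Submodule.zero_mem _

lemma cone_mem {S : Set P} {a : P} (ha : a ∈ S) {n : ℕ} {z : Chain k P n}
    (hz : z ∈ chainsIn k S n) : cone k a n z ∈ chainsIn k S (n + 1) := by
  simpa [Set.insert_eq_of_mem ha] using cone_mem_insert a hz

lemma boundary_zero_cone (a : P) (z : Chain k P 0) : boundary k 0 (cone k a 0 z) = z := by
  suffices h : boundary k 0 ∘ₗ cone k a 0 = LinearMap.id (M := Chain k P 0) from
    LinearMap.congr_fun h z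
  refine Finsupp.lhom_ext fun s c => ?_
  rw [LinearMap.comp_apply, cone_single (fun i => i.elim0), boundary_single]
  simp [OrderFace.face_cons_zero]

/-- Faces without the vertex `a` obey the usual cone formula. A face with top vertex `a` is
discarded by `cone`, but the cone over its boundary sees only the facet omitting `a` and gives the
face back, so both sides vanish. -/
lemma boundary_cone {a : P} {n : ℕ} {z : Chain k P (n + 1)}
    (hz : z ∈ chainsIn k (Set.Iic a) (n + 1)) :
    boundary k (n + 1) (cone k a (n + 1) z) = z - cone k a n (boundary k n z) := by
  suffices h : chainsIn k (Set.Iic a) (n + 1) ≤ LinearMap.ker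
      (boundary k (n + 1) ∘ₗ cone k a (n + 1) - (LinearMap.id - cone k a n ∘ₗ boundary k n)) by
    exact sub_eq_zero.1 (h hz)
  refine chainsIn_induction fun s hs => ?_
  rw [LinearMap.mem_ker, LinearMap.sub_apply, sub_eq_zero, LinearMap.sub_apply,
    LinearMap.comp_apply, LinearMap.comp_apply, LinearMap.id_apply, boundary_single k s, map_sum]
  by_cases h : ∀ i, s.1 i < a
  · rw [cone_single h, boundary_single, Fin.sum_univ_succ, OrderFace.face_cons_zero]
    simp only [OrderFace.face_cons_succ]
    rw [sub_eq_add_neg, ← Finset.sum_neg_distrib]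
    congr 1
    · simp
    · refine Finset.sum_congr rfl fun i _ => ?_
      rw [cone_single (s := s.face i) fun j => h (i.succAbove j), ← Finsupp.single_neg]
      simp [pow_succ]
  · have h0 : s.1 0 = a := by
      by_contra h0
      exact h fun i => lt_of_le_of_lt (s.2.antitone (Fin.zero_le i)) (lt_of_le_of_ne (hs 0) h0)
    subst h0
    have hlt : ∀ i, (s.face 0).1 i < s.1 0 := fun i => s.2 (by simp)
    rw [cone_single_of_not h, map_zero, eq_comm, sub_eq_zero, Fin.sum_univ_succ,
      cone_single hlt, OrderFace.cons_face_zero, Finset.sum_eq_zero]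
    · simp
    · intro i _
      cases n with
      | zero => exact i.elim0
      | succ n =>
        refine cone_single_of_not (fun hi => ?_) _
        have := hi 0
        simp [OrderFace.face] at this

lemma headPart_cone_self (a : P) {n : ℕ} (z : Chain k P n) :
    headPart k n a (cone k a n z) = cone k a n z := by
  suffices h : headPart k n a ∘ₗ cone k a n = cone k a n from LinearMap.congr_fun h z
  refine Finsupp.lhom_ext fun s c => ?_
  rw [LinearMap.comp_apply]
  by_cases h : ∀ i, s.1 i < a
  · rw [cone_single h]
    exact headPart_single_self k (s.cons a h) c
  · rw [cone_single_of_not h, map_zero]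

lemma headPart_cone_of_ne {a b : P} (hab : a ≠ b) {n : ℕ} (z : Chain k P n) :
    headPart k n b (cone k a n z) = 0 := by
  suffices h : headPart k n b ∘ₗ cone k a n = 0 from LinearMap.congr_fun h z
  refine Finsupp.lhom_ext fun s c => ?_
  rw [LinearMap.comp_apply, LinearMap.zero_apply]
  by_cases h : ∀ i, s.1 i < a
  · rw [cone_single h]
    exact headPart_single_of_ne k (s := s.cons a h) hab c
  · rw [cone_single_of_not h, map_zero]

end Cones

/-! ## Cellular chains -/

/-- The cells of an augmented chain complex with bases `B n`: the elements of `B (n + 1)` are the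
cells of dimension `n`, while `B 0` is the basis of the term of degree `-1`. -/
@[ext]
structure Cell (B : ℕ → Type) : Type where
  /-- the dimension -/
  dim : ℕ
  /-- the basis element -/
  idx : B (dim + 1)

section Cellular

variable {k : Type u} [Field k] {B : ℕ → Type}

variable (k) in
/-- The cellular chains supported on a set of cells. -/
def cellSub (S : Set (Cell B)) : ∀ n, Submodule k (B n → k)
  | 0 => ⊤
  | n + 1 => coordSub k {b | (⟨n, b⟩ : Cell B) ∈ S}

/-- The cycles of an augmented complex. -/
def cellCycles (δ : ∀ n, (B (n + 1) → k) →ₗ[k] (B n → k)) : ∀ n, Submodule k (B n → k)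
  | 0 => ⊤
  | n + 1 => LinearMap.ker (δ n)

/-- The cellular chains supported on `S` form an acyclic augmented complex. -/
def AcyclicOn (δ : ∀ n, (B (n + 1) → k) →ₗ[k] (B n → k)) (S : Set (Cell B)) : Prop :=
  ∀ n, ∀ v ∈ cellSub k S n, v ∈ cellCycles δ n → ∃ y ∈ cellSub k S (n + 1), δ n y = v

open scoped Classical in
/-- An order on the cells for which boundaries of cells are supported on smaller cells, and all
closed cells are acyclic. -/
structure IsCellOrder [PartialOrder (Cell B)] (δ : ∀ n, (B (n + 1) → k) →ₗ[k] (B n → k)) : Prop where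
  dim_lt : ∀ x y : Cell B, x < y → x.dim < y.dim
  lt_of_ne : ∀ n (b : B (n + 2)) (c : B (n + 1)), δ (n + 1) (Pi.single b 1) c ≠ 0 →
    (⟨n, c⟩ : Cell B) < ⟨n + 1, b⟩
  comp_eq_zero : ∀ n v, δ n (δ (n + 1) v) = 0
  acyclic : ∀ a : Cell B, AcyclicOn δ (Set.Iic a)

lemma cellSub_mono {S S' : Set (Cell B)} (h : S ⊆ S') : ∀ n, cellSub k S n ≤ cellSub k S' n
  | 0 => le_rfl
  | _ + 1 => coordSub_mono fun _ hb => h hb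

variable [∀ n, Fintype (B n)] [PartialOrder (Cell B)]
  (δ : ∀ n, (B (n + 1) → k) →ₗ[k] (B n → k))

open scoped Classical in
/-- The simplicial chain of the barycentric subdivision of a cell. -/
noncomputable def cellChain : ∀ n, B n → Chain k (Cell B) n
  | 0, _ => Finsupp.single (OrderFace.empty _) 1
  | n + 1, b => cone k ⟨n, b⟩ n (∑ c, δ n (Pi.single b 1) c • cellChain n c)

/-- The subdivision map from cellular chains to simplicial chains of the order complex. -/
noncomputable def subdiv (n : ℕ) : (B n → k) →ₗ[k] Chain k (Cell B) n :=
  Fintype.linearCombination k (cellChain δ n)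

lemma subdiv_apply (n : ℕ) (v : B n → k) : subdiv δ n v = ∑ c, v c • cellChain δ n c :=
  Fintype.linearCombination_apply k _ v

open scoped Classical in
lemma cellChain_succ (n : ℕ) (b : B (n + 1)) :
    cellChain δ (n + 1) b = cone k ⟨n, b⟩ n (subdiv δ n (δ n (Pi.single b 1))) := by
  rw [subdiv_apply, cellChain]

open scoped Classical in
lemma subdiv_single (n : ℕ) (b : B n) : subdiv δ n (Pi.single b 1) = cellChain δ n b := by
  rw [subdiv, Fintype.linearCombination_apply_single, one_smul]

lemma subdiv_zero [Unique (B 0)] (v : B 0 → k) :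
    subdiv δ 0 v = Finsupp.single (OrderFace.empty (Cell B)) (v default) := by
  rw [subdiv_apply, Fintype.sum_unique]
  exact Finsupp.smul_single_one _ _

variable {δ}

/-- Each cell chain is a cone whose apex is the cell itself, so top vertices separate the cells and
the coefficients can be read off. -/
lemma headPart_subdiv (n : ℕ) (v : B (n + 1) → k) (b : B (n + 1)) :
    headPart k n ⟨n, b⟩ (subdiv δ (n + 1) v) = v b • cellChain δ (n + 1) b := by
  rw [subdiv_apply, map_sum, Finset.sum_eq_single b]
  · rw [map_smul, cellChain_succ, headPart_cone_self]
  · intro c _ hc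
    rw [map_smul, cellChain_succ, headPart_cone_of_ne, smul_zero]
    rintro heq
    exact hc (by simpa using heq)
  · simp

namespace IsCellOrder

variable (h : IsCellOrder δ)
include h

open scoped Classical in
omit [∀ n, Fintype (B n)] in
lemma boundary_mem_cellSub (n : ℕ) (b : B (n + 1)) :
    δ n (Pi.single b 1) ∈ cellSub k (Set.Iio (⟨n, b⟩ : Cell B)) n := by
  cases n with
  | zero => trivial
  | succ n =>
    intro c hc
    by_contra h0
    exact hc (h.lt_of_ne n b c h0)

lemma subdiv_mem {S : Set (Cell B)} (hS : IsLowerSet S) {n : ℕ} {v : B n → k}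
    (hv : v ∈ cellSub k S n) : subdiv δ n v ∈ chainsIn k S n := by
  induction n generalizing S with
  | zero =>
    exact (Finsupp.mem_supported k _).2 fun s _ i => i.elim0
  | succ n ih =>
    rw [subdiv_apply]
    refine Submodule.sum_mem _ fun b _ => ?_
    by_cases hb : (⟨n, b⟩ : Cell B) ∈ S
    · refine Submodule.smul_mem _ _ ?_
      rw [cellChain_succ]
      exact cone_mem hb (chainsIn_mono k (fun x hx => hS (le_of_lt hx) hb) _
        (ih (isLowerSet_Iio _) (h.boundary_mem_cellSub n b)))
    · rw [hv b hb, zero_smul]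
      exact Submodule.zero_mem _

/-- The chain of a cell is a cone over its subdivided boundary. The correction term in the cone
formula is a cone over the subdivision of `δ (δ b) = 0`, so only the base remains. -/
lemma boundary_subdiv (n : ℕ) (v : B (n + 1) → k) :
    boundary k n (subdiv δ (n + 1) v) = subdiv δ n (δ n v) := by
  classical
  suffices hs : boundary k n ∘ₗ subdiv δ (n + 1) = subdiv δ n ∘ₗ δ n from
    LinearMap.congr_fun hs v
  refine LinearMap.pi_ext' fun b => LinearMap.ext_ring ?_
  change boundary k n (subdiv δ (n + 1) (Pi.single b 1)) = subdiv δ n (δ n (Pi.single b 1))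
  rw [subdiv_single, cellChain_succ]
  induction n with
  | zero => rw [boundary_zero_cone]
  | succ n ih =>
    have hc : ∀ v, boundary k n (subdiv δ (n + 1) v) = subdiv δ n (δ n v) := fun v => by
      suffices hs : boundary k n ∘ₗ subdiv δ (n + 1) = subdiv δ n ∘ₗ δ n from
        LinearMap.congr_fun hs v
      refine LinearMap.pi_ext' fun b => LinearMap.ext_ring ?_
      change boundary k n (subdiv δ (n + 1) (Pi.single b 1)) = subdiv δ n (δ n (Pi.single b 1))
      rw [subdiv_single, cellChain_succ]
      exact ih (Pi.single b 1) b
    rw [boundary_cone (chainsIn_mono k Set.Iio_subset_Iic_self _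
      (h.subdiv_mem (isLowerSet_Iio _) (h.boundary_mem_cellSub (n + 1) b))), hc,
      h.comp_eq_zero, map_zero, map_zero, sub_zero]

-- A cell with zero boundary would be a cycle of its own closed cell, so by acyclicity it would
-- bound a chain of one dimension more; the closed cell contains no cells of that dimension.
open scoped Classical in
omit [∀ n, Fintype (B n)] in
lemma boundary_single_ne_zero (n : ℕ) (b : B (n + 1)) : δ n (Pi.single b 1) ≠ 0 := by
  intro h0
  obtain ⟨y, hy, hyb⟩ := h.acyclic ⟨n, b⟩ (n + 1) (Pi.single b 1)
    (single_mem_coordSub (by exact le_refl (⟨n, b⟩ : Cell B)) 1) h0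
  have hy0 : y = 0 := funext fun c => hy c fun hc => by
    have hc' : (⟨n + 1, c⟩ : Cell B) ≤ ⟨n, b⟩ := hc
    rcases hc'.lt_or_eq with hlt | heq
    · exact absurd (h.dim_lt _ _ hlt) (by simp)
    · exact absurd (congrArg Cell.dim heq) (by simp)
  rw [hy0, map_zero] at hyb
  exact one_ne_zero (α := k) (by simpa using (congrFun hyb b).symm)

/-- Top vertices recover the coefficients as long as no cell chain is zero. A zero cell chain would
have zero subdivided boundary, contradicting injectivity one dimension lower. -/
lemma subdiv_injective [Unique (B 0)] (n : ℕ) : Function.Injective (subdiv δ n) := by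
  classical
  induction n with
  | zero =>
    refine (injective_iff_map_eq_zero _).2 fun v hv => ?_
    rw [subdiv_zero] at hv
    funext c
    rw [Unique.eq_default c, Finsupp.single_eq_zero.1 hv, Pi.zero_apply]
  | succ n ih =>
    refine (injective_iff_map_eq_zero _).2 fun v hv => funext fun b => ?_
    have h1 := headPart_subdiv (δ := δ) n v b
    rw [hv, map_zero, eq_comm] at h1
    refine (smul_eq_zero.1 h1).resolve_right fun h2 => h.boundary_single_ne_zero n b (ih ?_)
    rw [← h.boundary_subdiv, subdiv_single, h2, map_zero, map_zero]

/-- By acyclic carriers, every simplicial cycle is homologous to a subdivided cellular cycle with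
the same carrier. -/
lemma exists_carried_retraction [Unique (B 0)] (n : ℕ) :
    ∃ (Ψ : Chain k (Cell B) n →ₗ[k] (B n → k))
      (H : Chain k (Cell B) n →ₗ[k] Chain k (Cell B) (n + 1)),
      (∀ S, IsLowerSet S → ∀ w ∈ chainsIn k S n, Ψ w ∈ cellSub k S n ∧ H w ∈ chainsIn k S (n + 1)) ∧
      ∀ w ∈ redCycles k Set.univ n, Ψ w ∈ cellCycles δ n ∧
        subdiv δ n (Ψ w) - w = boundary k n (H w) := by
  classical
  induction n with
  | zero =>
    refine ⟨LinearMap.pi fun _ => Finsupp.lapply (OrderFace.empty _), 0,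
      fun S _ w _ => ⟨trivial, Submodule.zero_mem _⟩, fun w _ => ⟨trivial, ?_⟩⟩
    rw [LinearMap.zero_apply, map_zero, sub_eq_zero, subdiv_zero]
    refine Finsupp.ext fun s => ?_
    rw [s.eq_empty]
    exact Finsupp.single_eq_same
  | succ n ih =>
    obtain ⟨Ψ, H, hcar, hcyc⟩ := ih
    have hbd : ∀ w : Chain k (Cell B) (n + 1), boundary k n w ∈ redCycles k Set.univ n := fun w => by
      cases n with
      | zero => exact (Finsupp.mem_supported k _).2 fun s _ i => i.elim0
      | succ n =>
        exact ⟨(Finsupp.mem_supported k _).2 fun _ _ _ => trivial, boundary_boundary k w⟩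
    have hmem : ∀ s : OrderFace (Cell B) (n + 1),
        Finsupp.single s (1 : k) ∈ chainsIn k (Set.Iic (s.1 0)) (n + 1) := fun s =>
      single_mem_chainsIn (k := k) (S := Set.Iic (s.1 0))
        (fun i => s.2.antitone (Fin.zero_le i)) 1
    -- The carrier of a simplex is the closed cell of its largest vertex. Acyclicity of that cell
    -- lets `Ψ` be extended one dimension up without leaving the carrier.
    have hex : ∀ s : OrderFace (Cell B) (n + 1), ∃ y ∈ cellSub k (Set.Iic (s.1 0)) (n + 1),
        δ n y = Ψ (boundary k n (Finsupp.single s 1)) := fun s =>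
      h.acyclic (s.1 0) n _ (hcar _ (isLowerSet_Iic _) _ (boundary_mem k (hmem s))).1
        (hcyc _ (hbd _)).1
    choose y hy hyδ using hex
    -- `q s` is the defect that the homotopy must bound on `s`. It is a cycle in the closed cell of
    -- the top vertex, so its cone from that vertex bounds it.
    let q : OrderFace (Cell B) (n + 1) → Chain k (Cell B) (n + 1) := fun s =>
      subdiv δ (n + 1) (y s) - Finsupp.single s 1 - H (boundary k n (Finsupp.single s 1))
    have hq : ∀ s, q s ∈ chainsIn k (Set.Iic (s.1 0)) (n + 1) := fun s =>
      Submodule.sub_mem _ (Submodule.sub_mem _ (h.subdiv_mem (isLowerSet_Iic _) (hy s)) (hmem s))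
        (hcar _ (isLowerSet_Iic _) _ (boundary_mem k (hmem s))).2
    have hq0 : ∀ s, boundary k n (q s) = 0 := fun s => by
      simp only [q, map_sub]
      rw [h.boundary_subdiv, hyδ, ← (hcyc _ (hbd _)).2, sub_self]
    let Ψ' : Chain k (Cell B) (n + 1) →ₗ[k] (B (n + 1) → k) := Finsupp.linearCombination k y
    let H' : Chain k (Cell B) (n + 1) →ₗ[k] Chain k (Cell B) (n + 2) :=
      Finsupp.linearCombination k fun s => cone k (s.1 0) (n + 1) (q s)
    have hΨs : ∀ s, Ψ' (Finsupp.single s 1) = y s := fun s => by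
      simp [Ψ', Finsupp.linearCombination_single]
    have hHs : ∀ s, H' (Finsupp.single s 1) = cone k (s.1 0) (n + 1) (q s) := fun s => by
      simp [H', Finsupp.linearCombination_single]
    refine ⟨Ψ', H', fun S hS w hw => ?_, fun w hw => ?_⟩
    · suffices hle : chainsIn k S (n + 1) ≤
          (cellSub k S (n + 1)).comap Ψ' ⊓ (chainsIn k S (n + 2)).comap H' from hle hw
      refine chainsIn_induction fun s hs => ⟨?_, ?_⟩
      · rw [SetLike.mem_coe, Submodule.mem_comap, hΨs]
        exact cellSub_mono (hS.Iic_subset (hs 0)) _ (hy s)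
      · rw [SetLike.mem_coe, Submodule.mem_comap, hHs]
        exact cone_mem (hs 0) (chainsIn_mono k (hS.Iic_subset (hs 0)) _ (hq s))
    · have hw0 : boundary k n w = 0 := hw.2
      have h1 : δ n ∘ₗ Ψ' = Ψ ∘ₗ boundary k n := Finsupp.lhom_ext' fun s => LinearMap.ext_ring (by
        change δ n (Ψ' (Finsupp.single s 1)) = Ψ (boundary k n (Finsupp.single s 1))
        rw [hΨs, hyδ])
      have h2 : boundary k (n + 1) ∘ₗ H' =
          subdiv δ (n + 1) ∘ₗ Ψ' - LinearMap.id - H ∘ₗ boundary k n :=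
        Finsupp.lhom_ext' fun s => LinearMap.ext_ring (by
          change boundary k (n + 1) (H' (Finsupp.single s 1)) =
            subdiv δ (n + 1) (Ψ' (Finsupp.single s 1)) - Finsupp.single s 1 -
              H (boundary k n (Finsupp.single s 1))
          rw [hΨs, hHs, boundary_cone (hq s), hq0, map_zero, sub_zero])
      constructor
      · change δ n (Ψ' w) = 0
        have := LinearMap.congr_fun h1 w
        simpa [hw0] using this
      · have := LinearMap.congr_fun h2 w
        simp only [LinearMap.comp_apply, LinearMap.sub_apply, LinearMap.id_apply, hw0, map_zero,
          sub_zero] at this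
        exact this.symm

lemma exists_eq_subdiv_add_boundary [Unique (B 0)] {S : Set (Cell B)} (hS : IsLowerSet S) {n : ℕ}
    {w : Chain k (Cell B) n} (hw : w ∈ redCycles k S n) :
    ∃ z ∈ cellSub k S n, z ∈ cellCycles δ n ∧ ∃ y ∈ chainsIn k S (n + 1),
      w = subdiv δ n z + boundary k n y := by
  obtain ⟨Ψ, H, hcar, hcyc⟩ := h.exists_carried_retraction n
  have hwS : w ∈ chainsIn k S n ∧ w ∈ redCycles k Set.univ n := by
    cases n with
    | zero => exact ⟨hw, chainsIn_mono k (Set.subset_univ S) _ hw⟩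
    | succ n => exact ⟨hw.1, chainsIn_mono k (Set.subset_univ S) _ hw.1, hw.2⟩
  obtain ⟨h1, h2⟩ := hcar S hS w hwS.1
  obtain ⟨h3, h4⟩ := hcyc w hwS.2
  refine ⟨Ψ w, h1, h3, -H w, Submodule.neg_mem _ h2, ?_⟩
  rw [map_neg, ← h4]
  abel

end IsCellOrder

end Cellular

/-! ### Heights of cells and the homology of open lower sets. -/

namespace IsCellOrder

variable {k : Type u} [Field k] {B : ℕ → Type} [∀ n, Fintype (B n)] [PartialOrder (Cell B)]
  {δ : ∀ n, (B (n + 1) → k) →ₗ[k] (B n → k)} (h : IsCellOrder δ)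
include h

omit [∀ n, Fintype (B n)] in
lemma exists_lt (n : ℕ) (b : B (n + 2)) : ∃ c : B (n + 1), (⟨n, c⟩ : Cell B) < ⟨n + 1, b⟩ := by
  classical
  obtain ⟨c, hc⟩ := Function.ne_iff.1 (h.boundary_single_ne_zero (n + 1) b)
  exact ⟨c, h.lt_of_ne n b c hc⟩

-- Strict monotonicity of `dim` bounds the height from above. A cell of positive dimension has
-- nonzero boundary, hence a cell of one dimension less below it, and descending gives a chain of
-- full length.
omit [∀ n, Fintype (B n)] in
lemma height_eq (a : Cell B) : Order.height a = a.dim := by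
  refine le_antisymm ?_ ?_
  · have hm : StrictMono (Cell.dim : Cell B → ℕ) := fun x y hxy => h.dim_lt x y hxy
    have := Order.height_le_height_apply_of_strictMono _ hm a
    rwa [Order.height_nat] at this
  · obtain ⟨n, b⟩ := a
    induction n with
    | zero => simp
    | succ n ih =>
      obtain ⟨c, hc⟩ := h.exists_lt n b
      refine le_trans ?_ (Order.height_add_one_le hc)
      push_cast
      exact add_le_add_left (ih c) 1

omit [∀ n, Fintype (B n)] in
lemma chainHeight_Iio (a : Cell B) : (Set.Iio a).chainHeight (· < ·) = a.dim := by
  refine le_antisymm ?_ ?_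
  · rw [Set.chainHeight_eq_iSup]
    refine iSup_le fun t => ?_
    have hinj : Set.InjOn Cell.dim t.1 := fun x hx y hy hxy => by
      by_contra hne
      rcases t.2.2 hx hy hne with hlt | hlt
      · exact (h.dim_lt _ _ hlt).ne hxy
      · exact (h.dim_lt _ _ hlt).ne' hxy
    have hmaps : Set.MapsTo Cell.dim t.1 (Finset.range a.dim : Set ℕ) := fun x hx => by
      simpa using h.dim_lt _ _ (t.2.1 hx)
    have := Set.encard_le_encard_of_injOn hmaps hinj
    rwa [Set.encard_coe_eq_coe_finsetCard, Finset.card_range] at this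
  · obtain ⟨n, b⟩ := a
    suffices hs : ∃ t : Set (Cell B), t ⊆ Set.Iio ⟨n, b⟩ ∧ IsChain (· < ·) t ∧ t.encard = n by
      obtain ⟨t, h1, h2, h3⟩ := hs
      rw [← h3]
      exact Set.encard_le_chainHeight_of_isChain _ _ h1 h2
    induction n with
    | zero => exact ⟨∅, Set.empty_subset _, Set.subsingleton_empty.isChain, by simp⟩
    | succ n ih =>
      obtain ⟨c, hc⟩ := h.exists_lt n b
      obtain ⟨t, h1, h2, h3⟩ := ih c
      refine ⟨insert ⟨n, c⟩ t, ?_, h2.insert fun x hx _ => Or.inr (h1 hx), ?_⟩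
      · rintro x (rfl | hx)
        · exact hc
        · exact lt_trans (h1 hx) hc
      · rw [Set.encard_insert_of_notMem (fun hn => lt_irrefl _ (h1 hn)), h3]
        push_cast
        rfl

omit [∀ n, Fintype (B n)] in
lemma chainsIn_Iio_eq_bot {a : Cell B} {j : ℕ} (hj : a.dim < j) :
    chainsIn k (Set.Iio a) j = ⊥ := by
  obtain ⟨j, rfl⟩ : ∃ i, j = i + 1 := ⟨j - 1, by omega⟩
  rw [eq_bot_iff]
  refine chainsIn_induction fun s hs => ?_
  have h1 := le_height_head s
  rw [h.height_eq] at h1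
  have h2 := h.dim_lt _ _ (hs 0)
  have h3 : j ≤ (s.1 0).dim := by exact_mod_cast h1
  omega

omit [∀ n, Fintype (B n)] in
lemma chainsIn_Iic_eq_bot {a : Cell B} {j : ℕ} (hj : a.dim + 1 < j) :
    chainsIn k (Set.Iic a) j = ⊥ := by
  obtain ⟨j, rfl⟩ : ∃ i, j = i + 1 := ⟨j - 1, by omega⟩
  rw [eq_bot_iff]
  refine chainsIn_induction fun s hs => ?_
  have h1 := (le_height_head s).trans (Order.height_mono (hs 0))
  rw [h.height_eq] at h1
  have h3 : j ≤ a.dim := by exact_mod_cast h1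
  omega

open scoped Classical in
lemma subdiv_boundary_mem_redCycles (n : ℕ) (b : B (n + 1)) :
    subdiv δ n (δ n (Pi.single b 1)) ∈ redCycles k (Set.Iio (⟨n, b⟩ : Cell B)) n := by
  have h1 := h.subdiv_mem (isLowerSet_Iio _) (h.boundary_mem_cellSub n b)
  cases n with
  | zero => exact h1
  | succ n =>
    refine ⟨h1, ?_⟩
    change boundary k n _ = 0
    rw [h.boundary_subdiv, h.comp_eq_zero, map_zero]

omit [∀ n, Fintype (B n)] in
open scoped Classical in
lemma cellSub_Iic_top {n : ℕ} {b : B (n + 1)} {v : B (n + 1) → k}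
    (hv : v ∈ cellSub k (Set.Iic ⟨n, b⟩) (n + 1)) : v = v b • Pi.single b 1 := by
  funext c
  by_cases hc : c = b
  · subst hc; simp
  · rw [Pi.smul_apply, Pi.single_eq_of_ne hc, smul_zero]
    refine hv c fun hle => ?_
    have hle' : (⟨n, c⟩ : Cell B) ≤ ⟨n, b⟩ := hle
    rcases hle'.lt_or_eq with hlt | heq
    · exact absurd (h.dim_lt _ _ hlt) (lt_irrefl n)
    · exact hc (by simpa using heq)

omit h [∀ n, Fintype (B n)] in
lemma cellSub_Iic_of_ne {a : Cell B} {n : ℕ} (hn : n ≠ a.dim) :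
    cellSub k (Set.Iic a) (n + 1) ≤ cellSub k (Set.Iio a) (n + 1) :=
  coordSub_mono fun _ hb => lt_of_le_of_ne hb fun heq => hn (congrArg Cell.dim heq)

/-- Inside `Set.Iio a` the cycle is homologous to a subdivided cellular cycle, and the latter bounds
a cellular chain `y` in the acyclic closed cell. What remains to know is only whether `y` involves
`a` itself. -/
lemma exists_eq_of_mem_redCycles_Iio [Unique (B 0)] {a : Cell B} {j : ℕ} {w : Chain k (Cell B) j}
    (hw : w ∈ redCycles k (Set.Iio a) j) : ∃ y ∈ cellSub k (Set.Iic a) (j + 1),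
      ∃ y' ∈ chainsIn k (Set.Iio a) (j + 1), w = subdiv δ j (δ j y) + boundary k j y' := by
  obtain ⟨z, hz, hzc, y', hy', rfl⟩ := h.exists_eq_subdiv_add_boundary (isLowerSet_Iio a) hw
  obtain ⟨y, hy, rfl⟩ := h.acyclic a j z (cellSub_mono Set.Iio_subset_Iic_self _ hz) hzc
  exact ⟨y, hy, y', hy', rfl⟩

open scoped Classical in
lemma exists_smul_of_mem_redCycles_Iio [Unique (B 0)] {n : ℕ} {b : B (n + 1)}
    {w : Chain k (Cell B) n} (hw : w ∈ redCycles k (Set.Iio (⟨n, b⟩ : Cell B)) n) :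
    ∃ t : k, t • subdiv δ n (δ n (Pi.single b 1)) = w := by
  obtain ⟨y, hy, y', hy', rfl⟩ := h.exists_eq_of_mem_redCycles_Iio hw
  have hy0 : y' = 0 := by
    rw [h.chainsIn_Iio_eq_bot (Nat.lt_succ_self n)] at hy'
    exact hy'
  refine ⟨y b, ?_⟩
  rw [hy0, map_zero, add_zero]
  conv_rhs => rw [h.cellSub_Iic_top hy, map_smul, map_smul]

/-- The cellular filling can use the cell `a` only when `j = a.dim`. In every other degree it stays
in `Set.Iio a` and the homology vanishes. For `j = a.dim` there are no boundaries, and the cycles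
form the line spanned by the subdivided boundary of `a`. -/
theorem isHCWPoset [Unique (B 0)] : IsHCWPoset k (Cell B) := by
  classical
  intro a j
  rw [h.chainHeight_Iio]
  constructor
  · intro hj
    obtain rfl : j = a.dim := by exact_mod_cast hj
    obtain ⟨n, b⟩ := a
    set c : Chain k (Cell B) n := subdiv δ n (δ n (Pi.single b 1)) with hc
    have hcm : c ∈ redCycles k (Set.Iio (⟨n, b⟩ : Cell B)) n := h.subdiv_boundary_mem_redCycles n b
    have hc0 : c ≠ 0 := fun h0 => h.boundary_single_ne_zero n b
      (h.subdiv_injective n (by rw [map_zero]; exact h0))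
    have hbot : (((chainsIn k (Set.Iio (⟨n, b⟩ : Cell B)) (n + 1)).map (boundary k n)).submoduleOf
        (redCycles k (Set.Iio ⟨n, b⟩) n)) = ⊥ := by
      rw [h.chainsIn_Iio_eq_bot (Nat.lt_succ_self n), Submodule.map_bot, Submodule.submoduleOf,
        Submodule.comap_bot, Submodule.ker_subtype]
    let f : k →ₗ[k] redCycles k (Set.Iio (⟨n, b⟩ : Cell B)) n :=
      LinearMap.toSpanSingleton k _ ⟨c, hcm⟩
    have hf : Function.Bijective f := by
      constructor
      · refine (injective_iff_map_eq_zero _).2 fun t ht => ?_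
        have : t • c = 0 := congrArg Subtype.val ht
        exact (smul_eq_zero.1 this).resolve_right hc0
      · rintro ⟨w, hw⟩
        obtain ⟨t, ht⟩ := h.exists_smul_of_mem_redCycles_Iio hw
        exact ⟨t, Subtype.ext ht⟩
    exact ⟨(Submodule.quotEquivOfEqBot _ hbot).trans (LinearEquiv.ofBijective f hf).symm⟩
  · intro hj
    have hj' : j ≠ a.dim := by exact_mod_cast hj
    refine Submodule.Quotient.subsingleton_iff.2 (eq_top_iff.2 ?_)
    rintro ⟨w, hw⟩ -
    obtain ⟨y, hy, y', hy', rfl⟩ := h.exists_eq_of_mem_redCycles_Iio hw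
    refine ⟨subdiv δ (j + 1) y + y', Submodule.add_mem _
      (h.subdiv_mem (isLowerSet_Iio a) (cellSub_Iic_of_ne hj' hy)) hy', ?_⟩
    rw [map_add, h.boundary_subdiv]
    rfl

/-! ### The conic chain complex of a cell order -/

omit h [∀ n, Fintype (B n)] in
lemma isLowerSet_conicSkeleton (n : ℕ) : IsLowerSet (conicSkeleton (Cell B) n) :=
  fun _ _ hyx hx => lt_of_le_of_lt (Order.height_mono hyx) hx

lemma subdiv_mem_relCycles (n : ℕ) (v : B (n + 1) → k) :
    subdiv δ (n + 1) v ∈ relCycles k (conicSkeleton (Cell B) (n + 1)) (conicSkeleton (Cell B) n) n := by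
  refine ⟨h.subdiv_mem (isLowerSet_conicSkeleton _) fun b hb => absurd ?_ hb, ?_⟩
  · change Order.height (⟨n, b⟩ : Cell B) < ((n + 1 : ℕ) : ℕ∞)
    rw [h.height_eq]
    exact_mod_cast Nat.lt_succ_self n
  · rw [SetLike.mem_coe, Submodule.mem_comap, h.boundary_subdiv]
    refine h.subdiv_mem (isLowerSet_conicSkeleton _) ?_
    cases n with
    | zero => trivial
    | succ n =>
      refine fun b hb => absurd ?_ hb
      change Order.height (⟨n, b⟩ : Cell B) < ((n + 1 : ℕ) : ℕ∞)
      rw [h.height_eq]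
      exact_mod_cast Nat.lt_succ_self n

/-- The isomorphism of cellular chains with the terms of the conic chain complex. -/
noncomputable def toConic (n : ℕ) : (B (n + 1) → k) →ₗ[k] ConicX (Cell B) k n :=
  relMk k (conicSkeleton (Cell B) (n + 1)) (conicSkeleton (Cell B) n) n ∘ₗ
    (subdiv δ (n + 1)).codRestrict _ (h.subdiv_mem_relCycles n)

lemma conicD_toConic (n : ℕ) (v : B (n + 2) → k) :
    conicD k n (h.toConic (n + 1) v) = h.toConic n (δ (n + 1) v) := by
  refine congrArg (relMk k _ _ n) (Subtype.ext ?_)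
  exact h.boundary_subdiv (n + 1) v

lemma toConic_injective [Unique (B 0)] (n : ℕ) : Function.Injective (h.toConic n) := by
  refine (injective_iff_map_eq_zero _).2 fun v hv => ?_
  have h1 := (relMk_eq_zero_iff k _ _ n _).1 hv
  rw [relBoundaries_conicSkeleton] at h1
  exact h.subdiv_injective (n + 1) (h1.trans (map_zero _).symm)

-- The cone from the cell over a chain of top dimension in its closed cell would have too many
-- vertices, so it is zero; the cone formula then returns the chain itself as zero.
omit [∀ n, Fintype (B n)] in
lemma eq_zero_of_boundary_eq_zero {n : ℕ} {b : B (n + 1)} {z : Chain k (Cell B) (n + 1)}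
    (hz : z ∈ chainsIn k (Set.Iic (⟨n, b⟩ : Cell B)) (n + 1)) (hz0 : boundary k n z = 0) : z = 0 := by
  have h1 := boundary_cone hz
  have h2 : cone k (⟨n, b⟩ : Cell B) (n + 1) z = 0 := by
    have := cone_mem (S := Set.Iic (⟨n, b⟩ : Cell B)) (le_refl (⟨n, b⟩ : Cell B)) hz
    rw [h.chainsIn_Iic_eq_bot (Nat.lt_succ_self _)] at this
    exact this
  rw [h2, hz0, map_zero, map_zero, sub_zero] at h1
  exact h1.symm

open scoped Classical in
lemma cellChain_mem_relCycles {n : ℕ} (b : B (n + 1)) :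
    cellChain δ (n + 1) b ∈ relCycles k (Set.Iic (⟨n, b⟩ : Cell B)) (Set.Iio ⟨n, b⟩) n := by
  rw [← subdiv_single]
  refine ⟨h.subdiv_mem (isLowerSet_Iic _)
    (single_mem_coordSub (by exact le_refl (⟨n, b⟩ : Cell B)) 1), ?_⟩
  rw [SetLike.mem_coe, Submodule.mem_comap, h.boundary_subdiv]
  exact h.subdiv_mem (isLowerSet_Iio _) (h.boundary_mem_cellSub n b)

-- The boundary of a relative cycle of the closed cell is a top-dimensional cycle of the open one,
-- hence a multiple of the subdivided boundary of the cell. A chain of top dimension in a closed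
-- cell is determined by its boundary.
open scoped Classical in
lemma conicComp_eq_span [Unique (B 0)] (n : ℕ) (b : B (n + 1)) :
    conicComp k n (⟨n, b⟩ : Cell B) = Submodule.span k {h.toConic n (Pi.single b 1)} := by
  have hht : Order.height (⟨n, b⟩ : Cell B) = n := h.height_eq _
  ext x
  rw [mem_conicComp k hht, Submodule.mem_span_singleton]
  constructor
  · rintro ⟨z, hz, ⟨hz1, hz2⟩, rfl⟩
    have hzr : boundary k n z ∈ redCycles k (Set.Iio (⟨n, b⟩ : Cell B)) n := by
      cases n with
      | zero => exact hz2
      | succ n => exact ⟨hz2, boundary_boundary k z⟩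
    obtain ⟨t, ht⟩ := h.exists_smul_of_mem_redCycles_Iio hzr
    refine ⟨t, ?_⟩
    rw [← map_smul]
    refine congrArg (relMk k _ _ n) (Subtype.ext ?_)
    change subdiv δ (n + 1) (t • Pi.single b 1) = z
    refine sub_eq_zero.1 (h.eq_zero_of_boundary_eq_zero (b := b) (Submodule.sub_mem _ ?_ hz1) ?_)
    · rw [map_smul, subdiv_single]
      exact Submodule.smul_mem _ _ (h.cellChain_mem_relCycles b).1
    · rw [map_sub, map_smul, map_smul, h.boundary_subdiv, ht, sub_self]
  · rintro ⟨t, rfl⟩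
    refine ⟨subdiv δ (n + 1) (t • Pi.single b 1), h.subdiv_mem_relCycles n _, ?_, ?_⟩
    · rw [map_smul, subdiv_single]
      exact Submodule.smul_mem _ _ (h.cellChain_mem_relCycles b)
    · rw [← map_smul]
      rfl

omit [∀ n, Fintype (B n)] in
lemma conicComp_of_ne {n : ℕ} {a : Cell B} (ha : n ≠ a.dim) : conicComp k n a = ⊥ := by
  rw [conicComp, dif_neg]
  rw [h.height_eq]
  exact_mod_cast ha.symm

/-- This translates the grading of the conic complex into supports of cellular chains. With all
cells it gives surjectivity of `toConic`; with the cells of bounded degree it describes the strands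
of the homogenization. -/
lemma iSup_conicComp [Unique (B 0)] (n : ℕ) (S : Set (Cell B)) :
    ⨆ a ∈ S, conicComp k n a = (cellSub k S (n + 1)).map (h.toConic n) := by
  classical
  apply le_antisymm
  · refine iSup₂_le fun a ha => ?_
    by_cases hn : n = a.dim
    · subst hn
      rw [h.conicComp_eq_span, Submodule.span_singleton_le_iff_mem]
      exact ⟨Pi.single a.idx 1, single_mem_coordSub (k := k)
        (A := {b | (⟨a.dim, b⟩ : Cell B) ∈ S}) ha 1, rfl⟩
    · rw [h.conicComp_of_ne hn]
      exact bot_le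
  · rintro _ ⟨v, hv, rfl⟩
    rw [pi_eq_sum_univ' v, map_sum]
    refine Submodule.sum_mem _ fun b _ => ?_
    by_cases hb : (⟨n, b⟩ : Cell B) ∈ S
    · rw [map_smul]
      refine Submodule.smul_mem _ _ (Submodule.mem_iSup_of_mem ⟨n, b⟩
        (Submodule.mem_iSup_of_mem hb ?_))
      rw [h.conicComp_eq_span]
      convert Submodule.mem_span_singleton_self (h.toConic n (Pi.single b 1)) using 2
    · rw [hv b hb, zero_smul, map_zero]
      exact Submodule.zero_mem _

lemma toConic_surjective [Unique (B 0)] (n : ℕ) : Function.Surjective (h.toConic n) := by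
  classical
  intro x
  have hx : x ∈ ⨆ a ∈ (Set.univ : Set (Cell B)), conicComp k n a := by
    simp only [Set.mem_univ, iSup_pos]
    rw [(conicComp_isInternal k n).submodule_iSup_eq_top]
    trivial
  rw [h.iSup_conicComp] at hx
  obtain ⟨v, -, hv⟩ := hx
  exact ⟨v, hv⟩

end IsCellOrder

/-! ## Projections to homogeneous components -/

section Grading

variable {ι : Type*} [DecidableEq ι] {M : Type*} [AddCommGroup M] {g : ι → AddSubgroup M}

/-- The projection of an internally graded group onto a homogeneous component. -/
noncomputable def gradeProj (h : DirectSum.IsInternal g) (i : ι) : M →+ M :=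
  (g i).subtype.comp ((DFinsupp.evalAddMonoidHom i).comp
    (AddEquiv.ofBijective (DirectSum.coeAddMonoidHom g) h).symm.toAddMonoidHom)

variable (h : DirectSum.IsInternal g)

lemma gradeProj_coe (y : ⨁ i, g i) (i : ι) :
    gradeProj h i (DirectSum.coeAddMonoidHom g y) = y i := by
  have : (AddEquiv.ofBijective (DirectSum.coeAddMonoidHom g) h).symm
      (DirectSum.coeAddMonoidHom g y) = y :=
    (AddEquiv.ofBijective (DirectSum.coeAddMonoidHom g) h).symm_apply_apply y
  change (((AddEquiv.ofBijective (DirectSum.coeAddMonoidHom g) h).symm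
      (DirectSum.coeAddMonoidHom g y) i : g i) : M) = y i
  rw [this]

lemma gradeProj_mem (i : ι) (x : M) : gradeProj h i x ∈ g i := by
  obtain ⟨y, rfl⟩ := h.2 x
  rw [gradeProj_coe]
  exact (y i).2

lemma gradeProj_of_mem {i : ι} {x : M} (hx : x ∈ g i) : gradeProj h i x = x := by
  have := gradeProj_coe h (DirectSum.of (fun i => g i) i ⟨x, hx⟩) i
  rwa [DirectSum.coeAddMonoidHom_of, DirectSum.of_eq_same] at this

lemma gradeProj_of_mem_ne {i j : ι} (hij : i ≠ j) {x : M} (hx : x ∈ g i) : gradeProj h j x = 0 := by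
  have := gradeProj_coe h (DirectSum.of (fun i => g i) i ⟨x, hx⟩) j
  rwa [DirectSum.coeAddMonoidHom_of, DirectSum.of_eq_of_ne _ _ _ hij.symm] at this

lemma mem_of_gradeProj_mem {K : AddSubgroup M} {x : M} (hx : ∀ i, gradeProj h i x ∈ K) : x ∈ K := by
  classical
  obtain ⟨y, rfl⟩ := h.2 x
  rw [← DirectSum.sum_support_of y, map_sum]
  refine AddSubgroup.sum_mem _ fun i _ => ?_
  rw [DirectSum.coeAddMonoidHom_of, ← gradeProj_coe h]
  exact hx i

lemma map_gradeProj {N : Type*} [AddCommGroup N] {g' : ι → AddSubgroup N}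
    (h' : DirectSum.IsInternal g') (f : M →+ N) (hf : ∀ i, ∀ x ∈ g i, f x ∈ g' i) (i : ι) (x : M) :
    f (gradeProj h i x) = gradeProj h' i (f x) := by
  have hK : ∀ x, x ∈ (f.comp (gradeProj h i) - (gradeProj h' i).comp f).ker := fun x => by
    refine mem_of_gradeProj_mem h fun j => ?_
    rw [AddMonoidHom.mem_ker, AddMonoidHom.sub_apply, sub_eq_zero]
    have hj := gradeProj_mem h j x
    simp only [AddMonoidHom.comp_apply]
    by_cases hij : j = i
    · subst hij
      rw [gradeProj_of_mem h hj, gradeProj_of_mem h' (hf _ _ hj)]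
    · rw [gradeProj_of_mem_ne h hij hj, gradeProj_of_mem_ne h' hij (hf _ _ hj), map_zero]
  exact sub_eq_zero.1 (hK x)

/-- Exactness of graded maps can be checked on homogeneous elements. -/
lemma mem_of_homogeneous_of_map_eq_zero (h : DirectSum.IsInternal g) {N : Type*} [AddCommGroup N]
    {g' : ι → AddSubgroup N} (h' : DirectSum.IsInternal g') (f : M →+ N)
    (hf : ∀ i, ∀ x ∈ g i, f x ∈ g' i) (K : AddSubgroup M) (hK : ∀ i, ∀ x ∈ g i, f x = 0 → x ∈ K)
    {x : M} (hx : f x = 0) : x ∈ K :=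
  mem_of_gradeProj_mem h fun i => hK i _ (gradeProj_mem h i x) (by
    rw [map_gradeProj h h' f hf, hx, map_zero])

end Grading

/-! ## Homogeneous polynomials -/

section Poly

variable {k : Type u} [CommRing k] {m : ℕ}

lemma weight_single_eq (d : Fin m →₀ ℕ) :
    Finsupp.weight (fun i : Fin m => (Pi.single i 1 : Fin m → ℤ)) d = fun i => (d i : ℤ) := by
  funext i
  simp [Finsupp.weight_apply, Finsupp.sum_fintype, Finset.sum_apply, Pi.single_apply]

lemma xpow_natCast (d : Fin m →₀ ℕ) :
    xpow k (fun i => (d i : ℤ)) = MvPolynomial.monomial d 1 := by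
  rw [xpow]
  congr 1
  ext i
  simp

/-- For the fine grading the degree of a monomial determines its exponent, so a graded piece is
spanned by one monomial and is zero outside the nonnegative orthant. -/
lemma exists_eq_smul_xpow {α : Fin m → ℤ} {p : MvPolynomial (Fin m) k} (hp : p ∈ polyGrade k m α) :
    (∃ c : k, p = c • xpow k α) ∧ (¬ 0 ≤ α → p = 0) := by
  have hp' : ∀ d, p.coeff d ≠ 0 → (fun i => (d i : ℤ)) = α := fun d hd => by
    rw [← weight_single_eq]
    exact hp hd
  by_cases h0 : ∃ d, p.coeff d ≠ 0
  · obtain ⟨d, hd⟩ := h0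
    obtain rfl := hp' d hd
    refine ⟨⟨p.coeff d, ?_⟩, fun h => absurd (fun i => Int.natCast_nonneg _) h⟩
    rw [xpow_natCast]
    ext e
    rw [MvPolynomial.coeff_smul, MvPolynomial.coeff_monomial]
    split_ifs with he
    · rw [he]; simp
    · rw [smul_zero]
      by_contra hne
      refine he (Finsupp.ext fun i => ?_)
      have := congrFun (hp' e hne) i
      exact_mod_cast this.symm
  · push Not at h0
    have : p = 0 := MvPolynomial.ext _ _ fun d => by simp [h0 d]
    exact ⟨⟨0, by simp [this]⟩, fun _ => this⟩

lemma xpow_mem_span_X {β : Fin m → ℤ} (h : 0 ≤ β) (h0 : β ≠ 0) : xpow k β ∈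
    Ideal.span (Set.range (MvPolynomial.X : Fin m → MvPolynomial (Fin m) k)) := by
  obtain ⟨i, hi⟩ := Function.ne_iff.1 h0
  rw [← Set.image_univ, MvPolynomial.mem_ideal_span_X_image]
  intro d hd
  rw [xpow, MvPolynomial.mem_support_iff, MvPolynomial.coeff_monomial] at hd
  refine ⟨i, trivial, ?_⟩
  obtain rfl := (ite_ne_right_iff.1 hd).1
  have := h i
  simp only [Pi.zero_apply] at this hi
  simp only [Finsupp.equivFunOnFinite_symm_apply_apply]
  omega

lemma polyGrade_isInternal : DirectSum.IsInternal fun α => (polyGrade k m α).toAddSubgroup := by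
  have h : DirectSum.IsInternal fun α => polyGrade k m α := @DirectSum.Decomposition.isInternal _ _ _ _ _ _ _ _
    (MvPolynomial.weightedDecomposition k (fun i : Fin m => (Pi.single i 1 : Fin m → ℤ)))
  exact h

end Poly

/-! ## Homogenization as a resolution -/

namespace PGradedComplex

variable {k : Type u} [Field k] {P : Type w} [PartialOrder P] {m : ℕ}
  (F : PGradedComplex.{u, v, w} k P) (deg : P →o (Fin m → ℤ))

/-- The part of `F_n` in the components of degree at most `α`. -/
noncomputable def part (n : ℕ) (α : Fin m → ℤ) : Submodule k (F.X n) :=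
  ⨆ a ∈ {a : P | deg a ≤ α}, F.comp n a

variable {F deg}

lemma internalProj_of_mem_part {n : ℕ} {α : Fin m → ℤ} {x : F.X n} (hx : x ∈ F.part deg n α)
    {a : P} (ha : ¬ deg a ≤ α) : internalProj (F.isInternal n) a x = 0 := by
  suffices h : F.part deg n α ≤ LinearMap.ker (internalProj (F.isInternal n) a) from h hx
  refine iSup₂_le fun b hb y hy => ?_
  exact internalProj_of_ne _ (fun hba : b = a => ha (hba ▸ hb)) hy

variable [Fintype P]

open scoped Classical in
variable (F deg) in
/-- The identification of the part of `F_n` of degree at most `α` with the component of degree `α`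
of the homogenization. -/
noncomputable def homMap (n : ℕ) (α : Fin m → ℤ) : F.X n →ₗ[k] F.HomX m n :=
  ∑ a, DirectSum.lof k P (fun b => MvPolynomial (Fin m) k ⊗[k] F.comp n b) a ∘ₗ
    TensorProduct.mk k (MvPolynomial (Fin m) k) (F.comp n a) (xpow k (α - deg a)) ∘ₗ
      internalProj (F.isInternal n) a

lemma homMap_apply (n : ℕ) (α : Fin m → ℤ) (x : F.X n) (a : P) :
    F.homMap deg n α x a = xpow k (α - deg a) ⊗ₜ internalProj (F.isInternal n) a x := by
  classical
  rw [homMap, LinearMap.sum_apply, DirectSum.sum_apply, Finset.sum_eq_single a]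
  · simp [DirectSum.lof_apply]
  · intro b _ hb
    simp only [LinearMap.comp_apply, DirectSum.lof_eq_of]
    exact DirectSum.of_eq_of_ne _ _ _ hb.symm
  · simp

open scoped Classical in
lemma homMap_eq (n : ℕ) (α : Fin m → ℤ) (x : F.X n) :
    F.homMap deg n α x = ∑ a, DirectSum.lof (MvPolynomial (Fin m) k) P
      (fun b => MvPolynomial (Fin m) k ⊗[k] F.comp n b) a
        (xpow k (α - deg a) ⊗ₜ internalProj (F.isInternal n) a x) := by
  rw [homMap, LinearMap.sum_apply]
  rfl

/-- The coefficient of the monomial in each summand recovers the components of `x`. No condition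
relating `x` to `α` is needed: `xpow` truncates negative exponents and is always a monomial. -/
lemma homMap_eq_zero {n : ℕ} {α : Fin m → ℤ} {x : F.X n} (hx : F.homMap deg n α x = 0) : x = 0 := by
  rw [← sum_internalProj (F.isInternal n) x]
  refine Finset.sum_eq_zero fun a _ => ?_
  have h1 := homMap_apply (deg := deg) n α x a
  rw [hx, DirectSum.zero_apply] at h1
  have h2 := congrArg (TensorProduct.lid k (F.comp n a) ∘ LinearMap.rTensor (F.comp n a)
    (MvPolynomial.lcoeff (R := k)
      (Finsupp.equivFunOnFinite.symm fun i => ((α - deg a) i).toNat))) h1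
  simp only [Function.comp_apply, map_zero, LinearMap.rTensor_tmul, xpow, TensorProduct.lid_tmul] at h2
  rw [MvPolynomial.lcoeff_apply, MvPolynomial.coeff_monomial, if_pos rfl, one_smul] at h2
  rw [← h2]
  rfl

/-- In degree `α` the summand at `a` consists of multiples of the single monomial `x^(α - deg a)`
when `deg a ≤ α`, and is zero otherwise. -/
lemma exists_homMap_eq {n : ℕ} {α : Fin m → ℤ} {t : F.HomX m n} (ht : t ∈ F.homGrade deg n α) :
    ∃ x ∈ F.part deg n α, F.homMap deg n α x = t := by
  have h : ∀ a, ∃ v : F.comp n a, t a = xpow k (α - deg a) ⊗ₜ v ∧ (¬ deg a ≤ α → v = 0) := by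
    intro a
    have hta := ht a
    rw [tensorGrade_eq_span] at hta
    generalize t a = s at hta
    induction hta using Submodule.span_induction with
    | mem s hs =>
      obtain ⟨p, hp, x, rfl⟩ := hs
      obtain ⟨⟨c, hc⟩, h0⟩ := exists_eq_smul_xpow hp
      by_cases ha : deg a ≤ α
      · exact ⟨c • x, by rw [hc, TensorProduct.smul_tmul], fun h => absurd ha h⟩
      · exact ⟨0, by rw [h0 (fun h => ha (sub_nonneg.1 h))]; simp, fun _ => rfl⟩
    | zero => exact ⟨0, by simp, fun _ => rfl⟩
    | add s s' _ _ hs hs' =>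
      obtain ⟨v, rfl, hv⟩ := hs
      obtain ⟨v', rfl, hv'⟩ := hs'
      exact ⟨v + v', by rw [TensorProduct.tmul_add], fun h => by rw [hv h, hv' h, add_zero]⟩
    | smul c s _ hs =>
      obtain ⟨v, rfl, hv⟩ := hs
      exact ⟨c • v, by rw [TensorProduct.tmul_smul], fun h => by rw [hv h, smul_zero]⟩
  choose v hv hv0 using h
  refine ⟨∑ a, (v a : F.X n), Submodule.sum_mem _ fun a _ => ?_, ?_⟩
  · by_cases ha : deg a ≤ α
    · exact Submodule.mem_iSup_of_mem a (Submodule.mem_iSup_of_mem ha (v a).2)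
    · rw [hv0 a ha]
      exact Submodule.zero_mem _
  · refine DFinsupp.ext fun a => ?_
    refine (homMap_apply (deg := deg) n α _ a).trans ?_
    rw [hv a, map_sum, Finset.sum_eq_single a]
    · rw [internalProj_self _ (v a).2]
    · intro b _ hb
      exact internalProj_of_ne _ hb (v b).2
    · simp

/-- This identifies the strand of degree `α` with the subcomplex `part`: the monomials combine as
`x^(deg a - deg b) * x^(α - deg a) = x^(α - deg b)`. Membership in `part` is essential, since
truncated exponents would spoil this identity. -/
lemma homD_homMap {n : ℕ} {α : Fin m → ℤ} {x : F.X (n + 1)} (hx : x ∈ F.part deg (n + 1) α) :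
    F.homD deg n (F.homMap deg (n + 1) α x) = F.homMap deg n α (F.d n x) := by
  classical
  rw [homMap_eq, homMap_eq, map_sum]
  simp only [homD_lof]
  rw [Finset.sum_comm]
  refine Finset.sum_congr rfl fun b _ => ?_
  have hd : internalProj (F.isInternal n) b (F.d n x) =
      ∑ a, F.entry n a b (internalProj (F.isInternal (n + 1)) a x) := by
    conv_lhs => rw [← sum_internalProj (F.isInternal (n + 1)) x, map_sum, map_sum]
    rfl
  rw [hd, TensorProduct.tmul_sum, map_sum]
  refine Finset.sum_congr rfl fun a _ => ?_
  rw [← map_smul, LinearMap.baseChange_tmul, TensorProduct.smul_tmul']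
  by_cases ha : deg a ≤ α
  · by_cases hba : b ≤ a
    · rw [smul_eq_mul, xpow_mul k (sub_nonneg.2 (deg.monotone hba)) (sub_nonneg.2 ha)]
      congr 3
      abel
    · simp [F.entry_eq_zero n hba]
  · simp [internalProj_of_mem_part hx ha]

lemma exists_homogeneous_basis [∀ n a, FiniteDimensional k (F.comp n a)] (n : ℕ) :
    ∃ (r : ℕ) (b : Module.Basis (Fin r) (MvPolynomial (Fin m) k) (F.HomX m n)),
      ∀ i, ∃ α, b i ∈ F.homGrade deg n α := by
  classical
  let b : ∀ a, Module.Basis (Fin (Module.finrank k (F.comp n a))) (MvPolynomial (Fin m) k)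
      (MvPolynomial (Fin m) k ⊗[k] F.comp n a) := fun a =>
    (Module.finBasis k (F.comp n a)).baseChange (MvPolynomial (Fin m) k)
  let b' : Module.Basis (Σ a, Fin (Module.finrank k (F.comp n a))) (MvPolynomial (Fin m) k)
      (F.HomX m n) := DFinsupp.basis b
  obtain ⟨r, ⟨e⟩⟩ := Finite.exists_equiv_fin (Σ a, Fin (Module.finrank k (F.comp n a)))
  refine ⟨r, b'.reindex e, fun i => ⟨deg (e.symm i).1, ?_⟩⟩
  rw [Module.Basis.reindex_apply]
  have hb' : ∀ i, b' i = DirectSum.lof (MvPolynomial (Fin m) k) P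
      (fun b => MvPolynomial (Fin m) k ⊗[k] F.comp n b) i.1 (b i.1 i.2) := by
    intro i
    rw [Module.Basis.apply_eq_iff]
    change (sigmaFinsuppLequivDFinsupp (MvPolynomial (Fin m) k)).symm
      (DFinsupp.mapRange.linearEquiv (fun a => (b a).repr) (DFinsupp.single i.1 (b i.1 i.2))) = _
    rw [LinearEquiv.symm_apply_eq]
    simp
  rw [hb']
  refine F.lof_mem_homGrade deg n _ _ ?_
  rw [sub_self, tensorGrade_eq_span]
  refine Submodule.subset_span ⟨1, ?_, _, (Module.Basis.baseChange_apply _ _ _).symm⟩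
  exact MvPolynomial.isWeightedHomogeneous_one _ _

lemma d_mem_part {n : ℕ} {α : Fin m → ℤ} {x : F.X (n + 1)} (hx : x ∈ F.part deg (n + 1) α) :
    F.d n x ∈ F.part deg n α := by
  suffices h : F.part deg (n + 1) α ≤ (F.part deg n α).comap (F.d n) from h hx
  refine iSup₂_le fun a ha y hy => ?_
  rw [Submodule.mem_comap, ← sum_internalProj (F.isInternal n) (F.d n y)]
  refine Submodule.sum_mem _ fun b _ => ?_
  by_cases hba : b ≤ a
  · exact Submodule.mem_iSup_of_mem b
      (Submodule.mem_iSup_of_mem ((deg.monotone hba).trans ha) (Subtype.prop _))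
  · rw [F.d_triangular n a b hba y hy]
    exact Submodule.zero_mem _

/-- The homogenization of an augmented `P`-graded complex of vector spaces is a minimal free
resolution of a monomial ideal if the parts of bounded degree are exact. -/
theorem homogenize_isMinimalFreeResolution (I : Ideal (MvPolynomial (Fin m) k))
    (hI : IsMonomialIdeal I) [∀ n a, FiniteDimensional k (F.comp n a)] (hdeg : ∀ a, 0 ≤ deg a)
    (ε : F.X 0 →ₗ[k] k) (hεd : ∀ x, ε (F.d 0 x) = 0)
    (hεI : ∀ a, ∀ x ∈ F.comp 0 a, ε x ≠ 0 → xpow k (deg a) ∈ I)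
    (hεs : ∀ α, 0 ≤ α → xpow k α ∈ I → ∃ x ∈ F.part deg 0 α, ε x = 1)
    (hε : ∀ α, ∀ x ∈ F.part deg 0 α, ε x = 0 → ∃ y ∈ F.part deg 1 α, F.d 0 y = x)
    (hex : ∀ n α, ∀ x ∈ F.part deg (n + 1) α, F.d n x = 0 →
      ∃ y ∈ F.part deg (n + 2) α, F.d (n + 1) y = x)
    (hmin : ∀ n a b, deg a = deg b → F.entry n a b = 0) :
    (F.homogenize deg).IsMinimalFreeResolution I := by
  classical
  -- The augmentation is the homogenization of `ε`: in the summand at `a` it multiplies by `x^(deg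
  -- a)`, so on the strand of degree `α` it becomes `ε` times `x^α`.
  let η₀ : F.HomX m 0 →ₗ[MvPolynomial (Fin m) k] MvPolynomial (Fin m) k :=
    DirectSum.toModule (MvPolynomial (Fin m) k) P _ fun a =>
      xpow k (deg a) • ((TensorProduct.AlgebraTensorModule.rid k (MvPolynomial (Fin m) k)
        (MvPolynomial (Fin m) k)).toLinearMap ∘ₗ
          (ε ∘ₗ (F.comp 0 a).subtype).baseChange (MvPolynomial (Fin m) k))
  have hη₀ : ∀ a p x, η₀ (DirectSum.lof (MvPolynomial (Fin m) k) P
      (fun b => MvPolynomial (Fin m) k ⊗[k] F.comp 0 b) a (p ⊗ₜ x)) =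
        ε x • (xpow k (deg a) * p) := by
    intro a p x
    simp only [η₀, DirectSum.toModule_lof]
    simp
  have hηM : ∀ α, ∀ x ∈ F.part deg 0 α, η₀ (F.homMap deg 0 α x) = ε x • xpow k α := by
    intro α x hx
    rw [homMap_eq, map_sum]
    conv_rhs => rw [← sum_internalProj (F.isInternal 0) x, map_sum, Finset.sum_smul]
    refine Finset.sum_congr rfl fun a _ => ?_
    rw [hη₀]
    by_cases ha : deg a ≤ α
    · rw [xpow_mul k (hdeg a) (sub_nonneg.2 ha), add_sub_cancel]
    · simp [internalProj_of_mem_part hx ha]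
  have hηI : ∀ x, η₀ x ∈ I := by
    intro x
    rw [← DirectSum.sum_univ_of x, map_sum]
    refine Ideal.sum_mem _ fun a _ => ?_
    induction x a using TensorProduct.induction_on with
    | zero => simp
    | tmul p y =>
      refine (hη₀ a p y).symm ▸ ?_
      by_cases hy : ε y = 0
      · simp [hy]
      · rw [MvPolynomial.smul_eq_C_mul]
        exact I.mul_mem_left _ (I.mul_mem_right _ (hεI a y y.2 hy))
    | add s t hs ht => rw [map_add, map_add]; exact I.add_mem hs ht
  let η : F.HomX m 0 →ₗ[MvPolynomial (Fin m) k] I := η₀.codRestrict I hηI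
  have hηg : ∀ α, ∀ x ∈ F.homGrade deg 0 α, η₀ x ∈ polyGrade k m α := by
    intro α x hx
    obtain ⟨y, hy, rfl⟩ := exists_homMap_eq hx
    rw [hηM α y hy]
    by_cases hα : 0 ≤ α
    · exact Submodule.smul_mem _ _ (xpow_mem k hα)
    · have : y = 0 := by
        rw [← sum_internalProj (F.isInternal 0) y]
        refine Finset.sum_eq_zero fun a _ => ?_
        rw [internalProj_of_mem_part hy fun ha => hα ((hdeg a).trans ha)]
        rfl
      rw [this, map_zero, zero_smul]
      exact Submodule.zero_mem _
  refine ⟨fun n => ?_, ⟨η, ?_, ?_, hηg⟩, fun n => ?_, fun n => ?_⟩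
  · exact F.exists_homogeneous_basis n
  · rintro ⟨p, hp⟩
    have hle : I ≤ LinearMap.range η₀ := by
      obtain ⟨S, rfl⟩ := hI
      refine Ideal.span_le.2 ?_
      rintro _ ⟨s, hs, rfl⟩
      obtain ⟨x, hx, hx1⟩ := hεs (fun i => (s i : ℤ)) (fun i => Int.natCast_nonneg _)
        (by rw [xpow_natCast]; exact Ideal.subset_span ⟨s, hs, rfl⟩)
      exact ⟨F.homMap deg 0 _ x, by rw [hηM _ x hx, hx1, one_smul, xpow_natCast]⟩
    obtain ⟨x, hx⟩ := hle hp
    exact ⟨x, Subtype.ext hx⟩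
  · refine le_antisymm (fun x hx => ?_) ?_
    · refine mem_of_homogeneous_of_map_eq_zero (F.homGrade_isInternal deg 0) polyGrade_isInternal
        η₀.toAddMonoidHom hηg (LinearMap.range (F.homD deg 0)).toAddSubgroup (fun α y hy hy0 => ?_)
        (congrArg Subtype.val hx)
      obtain ⟨z, hz, rfl⟩ := exists_homMap_eq hy
      have hz0 : ε z = 0 := by
        by_contra hne
        have h1 : η₀ (F.homMap deg 0 α z) = 0 := hy0
        rw [hηM α z hz, xpow, MvPolynomial.smul_monomial, MvPolynomial.monomial_eq_zero] at h1
        exact hne (by simpa using h1)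
      obtain ⟨z', hz', rfl⟩ := hε α z hz hz0
      exact ⟨F.homMap deg 1 α z', homD_homMap hz'⟩
    · rintro _ ⟨y, rfl⟩
      refine Subtype.ext ?_
      change η₀ (F.homD deg 0 y) = 0
      have hy : y ∈ (η₀ ∘ₗ F.homD deg 0).toAddMonoidHom.ker := by
        refine mem_of_gradeProj_mem (F.homGrade_isInternal deg 1) fun α => ?_
        obtain ⟨z, hz, hzy⟩ := exists_homMap_eq (gradeProj_mem (F.homGrade_isInternal deg 1) α y)
        rw [← hzy]
        change η₀ (F.homD deg 0 (F.homMap deg 1 α z)) = 0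
        rw [homD_homMap hz, hηM α _ (d_mem_part hz), hεd, zero_smul]
      exact hy
  · refine le_antisymm (fun x hx => ?_) ?_
    · refine mem_of_homogeneous_of_map_eq_zero (F.homGrade_isInternal deg (n + 1))
        (F.homGrade_isInternal deg n) (F.homD deg n).toAddMonoidHom (F.homD_mem deg n)
        (LinearMap.range (F.homD deg (n + 1))).toAddSubgroup (fun α y hy hy0 => ?_) hx
      obtain ⟨z, hz, rfl⟩ := exists_homMap_eq hy
      obtain ⟨z', hz', rfl⟩ := hex n α z hz
        (homMap_eq_zero (deg := deg) (α := α) (by rw [← homD_homMap hz]; exact hy0))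
      exact ⟨F.homMap deg (n + 2) α z', homD_homMap hz'⟩
    · rintro _ ⟨y, rfl⟩
      exact F.homD_homD deg n y
  · suffices hle : LinearMap.range (F.homD deg n) ≤
        Ideal.span (Set.range (MvPolynomial.X : Fin m → MvPolynomial (Fin m) k)) •
          (⊤ : Submodule (MvPolynomial (Fin m) k) (F.HomX m n)) from hle
    rintro _ ⟨x, rfl⟩
    rw [← DirectSum.sum_univ_of x, map_sum]
    refine Submodule.sum_mem _ fun a _ => ?_
    rw [← DirectSum.lof_eq_of (MvPolynomial (Fin m) k), homD_lof]
    refine Submodule.sum_mem _ fun b _ => ?_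
    by_cases hab : deg a = deg b
    · rw [hmin n a b hab]
      simp
    by_cases hba : b ≤ a
    · exact Submodule.smul_mem_smul (xpow_mem_span_X (sub_nonneg.2 (deg.monotone hba))
        (sub_ne_zero.2 hab)) trivial
    · rw [F.entry_eq_zero n hba]
      simp

end PGradedComplex

/-! ## Uniqueness of minimal free resolutions -/

section GradedModules

variable {k : Type u} [Field k] {m : ℕ}
  {X : Type*} [AddCommGroup X] [Module (MvPolynomial (Fin m) k) X]
  {gX : (Fin m → ℤ) → AddSubgroup X} (hX : DirectSum.IsInternal gX)
  (sX : ∀ α β, ∀ p ∈ polyGrade k m α, ∀ x ∈ gX β, p • x ∈ gX (α + β))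
  {Y : Type*} [AddCommGroup Y] [Module (MvPolynomial (Fin m) k) Y]
  {gY : (Fin m → ℤ) → AddSubgroup Y} (hY : DirectSum.IsInternal gY)
  (sY : ∀ α β, ∀ p ∈ polyGrade k m α, ∀ x ∈ gY β, p • x ∈ gY (α + β))
  {N : Type*} [AddCommGroup N] [Module (MvPolynomial (Fin m) k) N]
  {gN : (Fin m → ℤ) → AddSubgroup N} (hN : DirectSum.IsInternal gN)

include sX in
lemma gradeProj_smul {β : Fin m → ℤ} {x : X} (hx : x ∈ gX β) (α : Fin m → ℤ)
    (p : MvPolynomial (Fin m) k) :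
    gradeProj hX α (p • x) = gradeProj (polyGrade_isInternal (k := k) (m := m)) (α - β) p • x := by
  let f : MvPolynomial (Fin m) k →+ X :=
    (LinearMap.toSpanSingleton (MvPolynomial (Fin m) k) X x).toAddMonoidHom
  suffices h : p ∈ ((gradeProj hX α).comp f -
      f.comp (gradeProj (polyGrade_isInternal (k := k) (m := m)) (α - β))).ker from sub_eq_zero.1 h
  refine mem_of_gradeProj_mem (polyGrade_isInternal (k := k) (m := m)) fun γ => ?_
  rw [AddMonoidHom.mem_ker, AddMonoidHom.sub_apply, sub_eq_zero]
  have hq := gradeProj_mem (polyGrade_isInternal (k := k) (m := m)) γ p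
  generalize gradeProj (polyGrade_isInternal (k := k) (m := m)) γ p = q at hq
  simp only [AddMonoidHom.comp_apply]
  have hqx : f q ∈ gX (γ + β) := sX γ β q hq x hx
  by_cases hγ : γ = α - β
  · subst hγ
    rw [gradeProj_of_mem (polyGrade_isInternal (k := k) (m := m)) hq, gradeProj_of_mem]
    rwa [sub_add_cancel] at hqx
  · rw [gradeProj_of_mem_ne (polyGrade_isInternal (k := k) (m := m)) hγ hq, map_zero]
    exact gradeProj_of_mem_ne hX (fun h => hγ (eq_sub_of_add_eq h)) hqx

variable {r : ℕ} (b : Module.Basis (Fin r) (MvPolynomial (Fin m) k) X) {β : Fin r → Fin m → ℤ}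
  (hb : ∀ i, b i ∈ gX (β i))

include hX sX hb in
lemma repr_mem_polyGrade {α : Fin m → ℤ} {x : X} (hx : x ∈ gX α) (i : Fin r) :
    b.repr x i ∈ polyGrade k m (α - β i) := by
  have h1 : x = ∑ j, gradeProj (polyGrade_isInternal (k := k) (m := m)) (α - β j) (b.repr x j) •
      b j := by
    conv_lhs => rw [← gradeProj_of_mem hX hx, ← b.sum_repr x, map_sum]
    exact Finset.sum_congr rfl fun j _ => gradeProj_smul hX sX (hb j) α _
  have h2 : b.repr x i =
      gradeProj (polyGrade_isInternal (k := k) (m := m)) (α - β i) (b.repr x i) := by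
    conv_lhs => rw [h1, b.repr_sum_self]
  rw [h2]
  exact gradeProj_mem (polyGrade_isInternal (k := k) (m := m)) _ _

-- Images of basis elements are lifted freely, and each lift is then replaced by its component in
-- the degree of the basis element.
include hX sX hY sY hN hb in
lemma exists_graded_lift (f : X →ₗ[MvPolynomial (Fin m) k] N) (hf : ∀ α, ∀ x ∈ gX α, f x ∈ gN α)
    (p : Y →ₗ[MvPolynomial (Fin m) k] N) (hp : ∀ α, ∀ y ∈ gY α, p y ∈ gN α)
    (hfp : LinearMap.range f ≤ LinearMap.range p) :
    ∃ ψ : X →ₗ[MvPolynomial (Fin m) k] Y, (∀ α, ∀ x ∈ gX α, ψ x ∈ gY α) ∧ ∀ x, p (ψ x) = f x := by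
  have hex : ∀ i, ∃ y ∈ gY (β i), p y = f (b i) := fun i => by
    obtain ⟨y, hy⟩ := hfp ⟨b i, rfl⟩
    refine ⟨gradeProj hY (β i) y, gradeProj_mem _ _ _, ?_⟩
    have := map_gradeProj hY hN p.toAddMonoidHom hp (β i) y
    refine this.trans ?_
    change gradeProj hN (β i) (p y) = _
    rw [hy, gradeProj_of_mem hN (hf _ _ (hb i))]
  choose y hy hyp using hex
  have hψ : p ∘ₗ b.constr (MvPolynomial (Fin m) k) y = f := b.ext fun i => by
    rw [LinearMap.comp_apply, b.constr_basis, hyp]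
  refine ⟨b.constr (MvPolynomial (Fin m) k) y, fun α x hx => ?_, LinearMap.congr_fun hψ⟩
  rw [b.constr_apply_fintype (MvPolynomial (Fin m) k)]
  refine AddSubgroup.sum_mem _ fun i _ => ?_
  have := sY _ _ _ (repr_mem_polyGrade hX sX b hb hx i) _ (hy i)
  rwa [sub_add_cancel] at this

-- Graded Nakayama: the coefficient of `b j` in `θ (b i) - b i` is homogeneous of degree `β i - β j`
-- and has no constant term, so it vanishes unless `β j < β i`. Induction on degrees gives
-- surjectivity, and a surjective endomorphism of a finite module is injective.
include hX sX hb in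
lemma bijective_of_congruent_id (θ : X →ₗ[MvPolynomial (Fin m) k] X)
    (hθ : ∀ α, ∀ x ∈ gX α, θ x ∈ gX α)
    (hid : ∀ x, θ x - x ∈ Ideal.span (Set.range (MvPolynomial.X : Fin m → MvPolynomial (Fin m) k)) •
      (⊤ : Submodule (MvPolynomial (Fin m) k) X)) : Function.Bijective θ := by
  have hsurj : Function.Surjective θ := by
    rw [← LinearMap.range_eq_top, ← top_le_iff, ← b.span_eq, Submodule.span_le]
    rintro _ ⟨i, rfl⟩
    have hwf : WellFounded fun i j : Fin r => β i < β j :=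
      haveI : IsTrans (Fin r) fun i j => β i < β j := ⟨fun _ _ _ => lt_trans⟩
      haveI : Std.Irrefl fun i j : Fin r => β i < β j := ⟨fun _ => lt_irrefl _⟩
      Finite.wellFounded_of_trans_of_irrefl _
    induction i using hwf.induction with
    | _ i ih =>
    set y := θ (b i) - b i with hy
    have hyg : y ∈ gX (β i) := AddSubgroup.sub_mem _ (hθ _ _ (hb i)) (hb i)
    have hyr : y ∈ LinearMap.range θ := by
      rw [← b.sum_repr y]
      refine Submodule.sum_mem _ fun j _ => ?_
      by_cases h0 : b.repr y j = 0
      · rw [h0, zero_smul]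
        exact Submodule.zero_mem _
      refine Submodule.smul_mem _ _ (ih j ?_)
      have hrep := exists_eq_smul_xpow (repr_mem_polyGrade hX sX b hb hyg j)
      refine lt_of_le_of_ne (sub_nonneg.1 (not_not.1 fun h => h0 (hrep.2 h))) fun heq => h0 ?_
      obtain ⟨c, hc⟩ := hrep.1
      have hle : Ideal.span (Set.range (MvPolynomial.X : Fin m → MvPolynomial (Fin m) k)) •
          (⊤ : Submodule (MvPolynomial (Fin m) k) X) ≤ Submodule.comap (b.coord j)
            (Ideal.span (Set.range (MvPolynomial.X : Fin m → MvPolynomial (Fin m) k))) :=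
        Submodule.smul_le.2 fun p hp x _ => by
          rw [Submodule.mem_comap, map_smul]
          exact Ideal.mul_mem_right _ _ hp
      have hm : b.repr y j ∈
          Ideal.span (Set.range (MvPolynomial.X : Fin m → MvPolynomial (Fin m) k)) := hle (hid _)
      rw [← Set.image_univ, MvPolynomial.mem_ideal_span_X_image] at hm
      by_contra hne
      have hsupp : (0 : Fin m →₀ ℕ) ∈ (b.repr y j).support := by
        have hc0 : c ≠ 0 := by
          rintro rfl
          exact hne (by rw [hc, zero_smul])
        rw [hc, heq, sub_self, xpow, MvPolynomial.mem_support_iff, MvPolynomial.coeff_smul]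
        rw [show (Finsupp.equivFunOnFinite.symm fun i => ((0 : Fin m → ℤ) i).toNat : Fin m →₀ ℕ) = 0
          from Finsupp.ext fun i => by simp]
        simpa using hc0
      obtain ⟨i, -, hi⟩ := hm 0 hsupp
      exact hi rfl
    have : b i = θ (b i) - y := by rw [hy]; abel
    rw [this]
    exact Submodule.sub_mem _ ⟨b i, rfl⟩ hyr
  have : Module.Finite (MvPolynomial (Fin m) k) X := Module.Finite.of_basis b
  exact ⟨OrzechProperty.injective_of_surjective_endomorphism θ hsurj, hsurj⟩

include hX sX hY sY hN hb in
/-- Uniqueness of graded minimal free covers. -/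
lemma exists_graded_equiv {r' : ℕ} (b' : Module.Basis (Fin r') (MvPolynomial (Fin m) k) Y)
    {β' : Fin r' → Fin m → ℤ} (hb' : ∀ i, b' i ∈ gY (β' i))
    (p : X →ₗ[MvPolynomial (Fin m) k] N) (hp : ∀ α, ∀ x ∈ gX α, p x ∈ gN α)
    (q : Y →ₗ[MvPolynomial (Fin m) k] N) (hq : ∀ α, ∀ y ∈ gY α, q y ∈ gN α)
    (hpq : LinearMap.range p = LinearMap.range q)
    (hpm : LinearMap.ker p ≤ Ideal.span (Set.range (MvPolynomial.X : Fin m → MvPolynomial (Fin m) k)) •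
      (⊤ : Submodule (MvPolynomial (Fin m) k) X))
    (hqm : LinearMap.ker q ≤ Ideal.span (Set.range (MvPolynomial.X : Fin m → MvPolynomial (Fin m) k)) •
      (⊤ : Submodule (MvPolynomial (Fin m) k) Y)) :
    ∃ e : X ≃ₗ[MvPolynomial (Fin m) k] Y,
      (∀ α x, e x ∈ gY α ↔ x ∈ gX α) ∧ ∀ x, q (e x) = p x := by
  obtain ⟨ψ, hψ, hψq⟩ := exists_graded_lift hX sX hY sY hN b hb p hp q hq hpq.le
  obtain ⟨χ, hχ, hχp⟩ := exists_graded_lift hY sY hX sX hN b' hb' q hq p hp hpq.ge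
  have h1 := bijective_of_congruent_id hX sX b hb (χ ∘ₗ ψ) (fun α x hx => hχ _ _ (hψ _ _ hx))
    fun x => hpm (by
      rw [LinearMap.mem_ker, map_sub, LinearMap.comp_apply, hχp, hψq, sub_self])
  have h2 := bijective_of_congruent_id hY sY b' hb' (ψ ∘ₗ χ) (fun α x hx => hψ _ _ (hχ _ _ hx))
    fun x => hqm (by
      rw [LinearMap.mem_ker, map_sub, LinearMap.comp_apply, hψq, hχp, sub_self])
  have hinj : Function.Injective ψ := Function.Injective.of_comp (f := χ) h1.1
  refine ⟨LinearEquiv.ofBijective ψ ⟨hinj, Function.Surjective.of_comp (g := χ) h2.2⟩,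
    fun α x => ⟨fun hx => ?_, hψ α x⟩, hψq⟩
  have hx' : ψ x ∈ gY α := hx
  have h3 : ψ (gradeProj hX α x) = ψ x :=
    (map_gradeProj hX hY ψ.toAddMonoidHom hψ α x).trans (gradeProj_of_mem hY hx')
  rw [← hinj h3]
  exact gradeProj_mem _ _ _

end GradedModules

lemma map_ker_of_comp_eq {R X Y K : Type*} [CommRing R] [AddCommGroup X] [Module R X]
    [AddCommGroup Y] [Module R Y] [AddCommGroup K] [Module R K] (e : X ≃ₗ[R] Y) (p : X →ₗ[R] K)
    (q : Y →ₗ[R] K) (h : ∀ x, q (e x) = p x) :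
    (LinearMap.ker p).map e.toLinearMap = LinearMap.ker q := by
  ext y
  constructor
  · rintro ⟨x, hx, rfl⟩
    exact (h x).trans hx
  · intro hy
    refine ⟨e.symm y, ?_, e.apply_symm_apply y⟩
    change p (e.symm y) = 0
    rw [← h, e.apply_symm_apply]
    exact hy

namespace MultigradedComplex

variable {k : Type u} [Field k] {m : ℕ} {I : Ideal (MvPolynomial (Fin m) k)}

/-- Any two minimal free resolutions are isomorphic. -/
theorem IsMinimalFreeResolution.nonempty_iso {F : MultigradedComplex.{u, v} k m}
    {G : MultigradedComplex.{u, w} k m} (hF : F.IsMinimalFreeResolution I)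
    (hG : G.IsMinimalFreeResolution I) : Nonempty (F.Iso G) := by
  obtain ⟨ε, hε, hεk, hεg⟩ := hF.augmentation
  obtain ⟨η, hη, hηk, hηg⟩ := hG.augmentation
  -- The induction also carries the equality of the images of the differentials: it makes the next
  -- two terms minimal covers of the same module.
  let T : ℕ → Type _ := fun n => {e : F.X n ≃ₗ[MvPolynomial (Fin m) k] G.X n //
    (∀ α x, e x ∈ G.grade n α ↔ x ∈ F.grade n α) ∧
      (LinearMap.range (F.d n)).map e.toLinearMap = LinearMap.range (G.d n)}
  have h0 : Nonempty (T 0) := by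
    obtain ⟨r, b, hb⟩ := hF.free 0
    obtain ⟨r', b', hb'⟩ := hG.free 0
    choose β hβ using hb
    choose β' hβ' using hb'
    obtain ⟨e, he, hee⟩ := exists_graded_equiv (F.isInternal 0) (F.smul_mem 0) (G.isInternal 0)
      (G.smul_mem 0) polyGrade_isInternal b hβ b' hβ' (I.subtype ∘ₗ ε) hεg (I.subtype ∘ₗ η) hηg
      (by rw [LinearMap.range_comp, LinearMap.range_comp, LinearMap.range_eq_top.2 hε,
            LinearMap.range_eq_top.2 hη])
      (by
        rw [LinearMap.ker_comp, Submodule.ker_subtype, Submodule.comap_bot, hεk]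
        exact hF.minimal 0)
      (by
        rw [LinearMap.ker_comp, Submodule.ker_subtype, Submodule.comap_bot, hηk]
        exact hG.minimal 0)
    refine ⟨e, he, ?_⟩
    rw [← hεk, ← hηk]
    exact map_ker_of_comp_eq e ε η fun x => Subtype.ext (hee x)
  have hs : ∀ n (e : T n), ∃ e' : T (n + 1), ∀ x, e.1 (F.d n x) = G.d n (e'.1 x) := by
    rintro n ⟨e, he, her⟩
    obtain ⟨r, b, hb⟩ := hF.free (n + 1)
    obtain ⟨r', b', hb'⟩ := hG.free (n + 1)
    choose β hβ using hb
    choose β' hβ' using hb'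
    obtain ⟨e', he', hee⟩ := exists_graded_equiv (F.isInternal (n + 1)) (F.smul_mem (n + 1))
      (G.isInternal (n + 1)) (G.smul_mem (n + 1)) (G.isInternal n) b hβ b' hβ'
      (e.toLinearMap ∘ₗ F.d n) (fun α x hx => (he _ _).2 (F.d_mem n α x hx)) (G.d n) (G.d_mem n)
      (by rw [LinearMap.range_comp, her])
      (by
        rw [LinearMap.ker_comp, LinearEquiv.ker, Submodule.comap_bot, hF.exact]
        exact hF.minimal (n + 1))
      (by
        rw [hG.exact]
        exact hG.minimal (n + 1))
    refine ⟨⟨e', he', ?_⟩, fun x => (hee x).symm⟩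
    rw [← hF.exact, ← hG.exact, ← map_ker_of_comp_eq e' _ _ hee, LinearMap.ker_comp, LinearEquiv.ker,
      Submodule.comap_bot]
  choose s hs using hs
  let t : ∀ n, T n := fun n => Nat.rec h0.some s n
  exact ⟨⟨fun n => (t n).1, fun n x => hs n (t n) x, fun n => (t n).2.1⟩⟩

end MultigradedComplex

/-! ## Minimal complexes of circuits -/

section CircuitComplex

open scoped Classical in
/-- An augmented complex with bases `B n`, filtered by a poset `Λ`, which is minimal and exact in
the degrees in `J`, and in which the boundaries of basis elements are circuits. -/
structure CircuitComplex (k : Type u) [Field k] (Λ : Type) [PartialOrder Λ] (J : Set Λ) where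
  /-- the bases -/
  B : ℕ → Type
  [fintype : ∀ n, Fintype (B n)]
  [unique : Unique (B 0)]
  /-- the differential -/
  δ : ∀ n, (B (n + 1) → k) →ₗ[k] (B n → k)
  /-- the degrees of the basis elements -/
  deg : ∀ n, B (n + 1) → Λ
  /-- the cycles of degree at most `α` -/
  Z : ∀ n, Λ → Submodule k (B n → k)
  Z_zero : ∀ α ∈ J, Z 0 α = ⊤
  Z_zero_of_notMem : ∀ α, α ∉ J → Z 0 α = ⊥
  Z_succ : ∀ n α, Z (n + 1) α = LinearMap.ker (δ n) ⊓ coordSub k {i | deg n i ≤ α}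
  isCircuitIn : ∀ n i, IsCircuitIn (Z n (deg n i)) (δ n (Pi.single i 1))
  exact : ∀ n α, Z n α ≤ (coordSub k {i | deg n i ≤ α}).map (δ n)
  minimal : ∀ n v, δ n v = 0 → ∀ i, v ∈ coordSub k {j | deg n j ≤ deg n i} → v i = 0

attribute [instance] CircuitComplex.fintype CircuitComplex.unique

/-- One step of the construction of a complex of circuits: a basis and its filtered cycles. -/
structure CircuitStage (k : Type u) [Field k] (Λ : Type) [PartialOrder Λ] where
  /-- the number of basis elements -/
  size : ℕ
  /-- the cycles -/
  cycles : Λ →o Submodule k (Fin size → k)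

/-- The generators found at one stage index the basis of the next, whose filtered cycles lie in the
kernel of the new differential. The initial stage is a line in homological degree -1, present
exactly in the degrees of `J`; monotonicity uses that `J` is an upper set. -/
theorem nonempty_circuitComplex (k : Type u) [Field k] {Λ : Type} [PartialOrder Λ] [Finite Λ]
    {J : Set Λ} (hJ : IsUpperSet J) : Nonempty (CircuitComplex k Λ J) := by
  classical
  have hstep := fun s : CircuitStage k Λ => exists_circuit_generators s.cycles
  choose r deg δ hc he hm using hstep
  let next : CircuitStage k Λ → CircuitStage k Λ := fun s =>
    { size := r s
      cycles := ⟨fun α => LinearMap.ker (δ s) ⊓ coordSub k {i | deg s i ≤ α}, fun α α' h =>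
        inf_le_inf le_rfl (coordSub_mono fun i hi => le_trans hi h)⟩ }
  let init : CircuitStage k Λ :=
    { size := 1
      cycles := ⟨fun α => ⨆ _ : α ∈ J, ⊤, fun α α' h => iSup_le fun hα => le_iSup_of_le (hJ h hα) le_rfl⟩ }
  let s : ℕ → CircuitStage k Λ := fun n => Nat.rec init (fun _ => next) n
  exact ⟨{
    B := fun n => Fin (s n).size
    unique := inferInstanceAs (Unique (Fin 1))
    δ := fun n => δ (s n)
    deg := fun n => deg (s n)
    Z := fun n => (s n).cycles
    Z_zero := fun α hα => iSup_pos hα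
    Z_zero_of_notMem := fun α hα => iSup_neg hα
    Z_succ := fun n α => rfl
    isCircuitIn := fun n i => by convert hc (s n) i
    exact := fun n α => he (s n) α
    minimal := fun n v hv i => hm (s n) v hv i }⟩

namespace CircuitComplex

variable {k : Type u} [Field k] {Λ : Type} [PartialOrder Λ] {J : Set Λ} (C : CircuitComplex k Λ J)

/-- The degree of a cell. -/
def cellDeg (x : Cell C.B) : Λ := C.deg x.dim x.idx

open scoped Classical in
lemma δ_single_mem (n : ℕ) (i : C.B (n + 2)) :
    C.δ (n + 1) (Pi.single i 1) ∈
      LinearMap.ker (C.δ n) ⊓ coordSub k {j | C.deg n j ≤ C.deg (n + 1) i} := by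
  rw [← C.Z_succ]
  exact (C.isCircuitIn (n + 1) i).1

lemma δ_δ (n : ℕ) (v : C.B (n + 2) → k) : C.δ n (C.δ (n + 1) v) = 0 := by
  classical
  suffices h : C.δ n ∘ₗ C.δ (n + 1) = 0 from LinearMap.congr_fun h v
  refine LinearMap.pi_ext' fun i => LinearMap.ext_ring ?_
  exact (C.δ_single_mem n i).1

-- The boundary of a basis element is a relation among elements of degree at most its own, and
-- minimality forbids a relation from involving an element whose degree bounds all the others.
open scoped Classical in
lemma δ_single_eq_zero {n : ℕ} {i : C.B (n + 2)} {j : C.B (n + 1)}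
    (h : C.deg n j = C.deg (n + 1) i) : C.δ (n + 1) (Pi.single i 1) j = 0 :=
  C.minimal n _ (C.δ_single_mem n i).1 j (h ▸ (C.δ_single_mem n i).2)

lemma exists_deg_lt (n : ℕ) (i : C.B (n + 2)) : ∃ j, C.deg n j < C.deg (n + 1) i := by
  classical
  obtain ⟨j, hj⟩ := Function.ne_iff.1 (C.isCircuitIn (n + 1) i).2.1
  refine ⟨j, lt_of_le_of_ne ?_ fun h => hj (C.δ_single_eq_zero h)⟩
  by_contra h
  exact hj ((C.δ_single_mem n i).2 j h)

lemma deg_mem (hJ : IsUpperSet J) (n : ℕ) (i : C.B (n + 1)) : C.deg n i ∈ J := by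
  classical
  induction n with
  | zero =>
    by_contra h
    have h1 := C.isCircuitIn 0 i
    rw [C.Z_zero_of_notMem _ h] at h1
    exact h1.2.1 h1.1
  | succ n ih =>
    obtain ⟨j, hj⟩ := C.exists_deg_lt n i
    exact hJ hj.le (ih j)

/-- Under each cell of positive dimension there is one of the next lower dimension and strictly
smaller degree, so a finite set of degrees bounds the dimensions. -/
lemma finite_cell [Finite Λ] : Finite (Cell C.B) := by
  have h : ∀ n (i : C.B (n + 1)), n ≤ (Set.Iio (C.deg n i)).ncard := by
    intro n
    induction n with
    | zero => exact fun _ => Nat.zero_le _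
    | succ n ih =>
      intro i
      obtain ⟨j, hj⟩ := C.exists_deg_lt n i
      exact lt_of_le_of_lt (ih j) (Set.ncard_lt_ncard (Set.Iio_ssubset_Iio hj) (Set.toFinite _))
  have h' : ∀ x : Cell C.B, x.dim < Nat.card Λ + 1 := fun x =>
    Nat.lt_succ_of_le ((h x.dim x.idx).trans (Set.ncard_le_card _))
  let f : Cell C.B → Σ n : Fin (Nat.card Λ + 1), C.B (n + 1) := fun x => ⟨⟨x.dim, h' x⟩, x.idx⟩
  refine Finite.of_injective f fun x y hxy => ?_
  obtain ⟨n, i⟩ := x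
  obtain ⟨n', i'⟩ := y
  simp only [f, Sigma.mk.injEq, Fin.mk.injEq] at hxy
  obtain ⟨rfl, h2⟩ := hxy
  rw [eq_of_heq h2]

lemma mem_Z_of_mem_cellSub {S : Set (Cell C.B)} {α : Λ} (hα : α ∈ J)
    (hS : ∀ x ∈ S, C.cellDeg x ≤ α) {n : ℕ} {v : C.B n → k} (hv : v ∈ cellSub k S n)
    (hvc : v ∈ cellCycles C.δ n) : v ∈ C.Z n α := by
  cases n with
  | zero => rw [C.Z_zero α hα]; trivial
  | succ n =>
    rw [C.Z_succ]
    exact ⟨hvc, coordSub_mono (fun i hi => hS ⟨n, i⟩ hi) hv⟩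

lemma acyclicOn_deg_le {α : Λ} (hα : α ∈ J) : AcyclicOn C.δ {x | C.cellDeg x ≤ α} := by
  intro n v hv hvc
  obtain ⟨y, hy, rfl⟩ := C.exact n α (C.mem_Z_of_mem_cellSub hα (fun x hx => hx) hv hvc)
  exact ⟨y, hy, rfl⟩

theorem exists_isCellOrder (hJ : IsUpperSet J) : ∃ _ : PartialOrder (Cell C.B),
    IsCellOrder C.δ ∧ Monotone C.cellDeg := by
  classical
  have hD := fun n (i : C.B (n + 2)) =>
    exists_spanning_of_circuit (C.δ n) {j | C.deg n j ≤ C.deg (n + 1) i}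
      (by rw [← C.Z_succ]; exact C.isCircuitIn (n + 1) i)
  choose D hDdeg hDc hDker hDspan using hD
  let r : Cell C.B → Cell C.B → Prop := fun x y =>
    (x.dim + 2 ≤ y.dim ∧ C.cellDeg x ≤ C.cellDeg y) ∨
      ∃ n, ∃ (i : C.B (n + 2)) (j : C.B (n + 1)), y = ⟨n + 1, i⟩ ∧ x = ⟨n, j⟩ ∧ j ∈ D n i
  have hrdim : ∀ {x y}, r x y → x.dim < y.dim := by
    rintro x y (⟨h, -⟩ | ⟨n, i, j, rfl, rfl, -⟩)
    · omega
    · exact Nat.lt_succ_self n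
  have hrdeg : ∀ {x y}, r x y → C.cellDeg x ≤ C.cellDeg y := by
    rintro x y (⟨-, h⟩ | ⟨n, i, j, rfl, rfl, h⟩)
    · exact h
    · exact hDdeg n i h
  have hrD : ∀ {n} {i : C.B (n + 2)} {j : C.B (n + 1)}, r ⟨n, j⟩ ⟨n + 1, i⟩ → j ∈ D n i := by
    rintro n i j (⟨h, -⟩ | ⟨n', i', j', h1, h2, h3⟩)
    · simp only at h
      omega
    · cases h1
      cases h2
      exact h3
  -- Two successive relations lower the dimension by at least two, where only degrees matter, so
  -- transitivity imposes no condition on the sets `D`.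
  have hso : IsStrictOrder (Cell C.B) r :=
    { irrefl := fun x hx => lt_irrefl _ (hrdim hx)
      trans := fun x y z hxy hyz => Or.inl ⟨by
        have := hrdim hxy
        have := hrdim hyz
        omega, (hrdeg hxy).trans (hrdeg hyz)⟩ }
  refine ⟨partialOrderOfSO r, ?_⟩
  let _ := partialOrderOfSO r
  have hle : ∀ {x y : Cell C.B}, x ≤ y → x = y ∨ r x y := fun h => h
  have hmono : ∀ {x y : Cell C.B}, x ≤ y → C.cellDeg x ≤ C.cellDeg y := fun {x y} h => by
    rcases hle h with rfl | h
    · exact le_rfl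
    · exact hrdeg h
  refine ⟨⟨fun x y h => hrdim h, fun n i j h => ?_, C.δ_δ, ?_⟩, fun x y h => hmono h⟩
  · refine Or.inr ⟨n, i, j, rfl, rfl, ?_⟩
    by_contra hj
    exact h (hDc n i j hj)
  · rintro ⟨n, i⟩ j v hv hvc
    have hZ : v ∈ C.Z j (C.deg n i) :=
      C.mem_Z_of_mem_cellSub (C.deg_mem hJ n i) (fun x hx => hmono hx) hv hvc
    -- A cycle indexed by `j` has dimension `j - 1`. Above dimension `n` the closed cell has no
    -- chains; in dimension `n` only multiples of the cell occur, and minimality excludes nonzero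
    -- cycles.
    rcases lt_trichotomy (n + 1) j with hj | rfl | hj
    · obtain ⟨j, rfl⟩ : ∃ j', j = j' + 1 := ⟨j - 1, by omega⟩
      have hv0 : v = 0 := funext fun b => hv b fun hb => by
        rcases hle hb with hb | hb
        · have := congrArg Cell.dim hb
          simp only at this
          omega
        · have := hrdim hb
          simp only at this
          omega
      exact ⟨0, Submodule.zero_mem _, by rw [map_zero, hv0]⟩
    · have hv0 : v = 0 := funext fun b => by
        by_cases hb : b = i
        · subst hb
          rw [C.Z_succ] at hZ
          exact C.minimal n v hZ.1 b hZ.2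
        · refine hv b fun hbi => ?_
          rcases hle hbi with hbi | hbi
          · exact hb (by simpa using hbi)
          · exact absurd (hrdim hbi) (lt_irrefl n)
      exact ⟨0, Submodule.zero_mem _, by rw [map_zero, hv0]⟩
    · obtain hj | rfl := (Nat.lt_succ_iff.1 hj).lt_or_eq
      -- Exactness gives a filling of dimension `j` by cells of degree at most that of the closed
      -- cell. If `j + 2 ≤ n` all these cells lie below it. If `j + 1 = n`, the filling is replaced
      -- by one supported on `D`, which has the same image.
      · obtain ⟨y, hy, rfl⟩ := C.exact j _ hZ
        obtain hj | rfl := (Nat.succ_le_of_lt hj).lt_or_eq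
        · exact ⟨y, fun b hb => hy b fun hb' => hb (Or.inr (Or.inl ⟨hj, hb'⟩)), rfl⟩
        · obtain ⟨z, hz, hzy⟩ := hDspan j i ⟨y, hy, rfl⟩
          exact ⟨z, fun b hb => hz b fun hb' =>
            hb (Or.inr (Or.inr ⟨j, i, b, rfl, rfl, hb'⟩)), hzy⟩
      -- In codimension one, the only cycles supported on `D` are multiples of the boundary of the
      -- cell. For a vertex, the term of dimension -1 is a line spanned by its nonzero boundary.
      · suffices ht : ∃ t : k, v = t • C.δ j (Pi.single i 1) by
          obtain ⟨t, rfl⟩ := ht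
          exact ⟨t • Pi.single i 1, Submodule.smul_mem _ _
            (single_mem_coordSub (by exact le_refl (⟨j, i⟩ : Cell C.B)) 1), by rw [map_smul]⟩
        cases j with
        | zero =>
          obtain ⟨-, h0, hmin⟩ := C.isCircuitIn 0 i
          refine hmin v hZ fun b hb => absurd (funext fun b' => ?_) h0
          rw [Subsingleton.elim b' b, hb, Pi.zero_apply]
        | succ j =>
          refine hDker j i v (fun b hb => hv b fun hb' => hb ?_) hvc
          rcases hle hb' with hb' | hb'
          · have := congrArg Cell.dim hb'
            simp at this
          · exact hrD hb'

end CircuitComplex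

end CircuitComplex

/-! ## Resolutions of monomial ideals -/

/-- Noetherianity extracts finitely many of the monomial generators, and a monomial lies in a
monomial ideal exactly when some generator divides it. -/
lemma IsMonomialIdeal.exists_finset {k : Type u} [Field k] {m : ℕ}
    {I : Ideal (MvPolynomial (Fin m) k)} (hI : IsMonomialIdeal I) :
    ∃ T : Finset (Fin m →₀ ℕ), ∀ α : Fin m → ℤ, 0 ≤ α →
      (xpow k α ∈ I ↔ ∃ s ∈ T, ∀ i, (s i : ℤ) ≤ α i) := by
  obtain ⟨S, rfl⟩ := hI
  obtain ⟨t, htS, ht⟩ := Submodule.fg_span_iff_fg_span_finset_subset _ |>.1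
    (IsNoetherian.noetherian (Ideal.span ((fun s => MvPolynomial.monomial s (1 : k)) '' S)))
  classical
  obtain ⟨T, -, rfl⟩ := Finset.subset_set_image_iff.1 htS
  refine ⟨T, fun α hα => ?_⟩
  have h : xpow k α ∈ Ideal.span ((fun s => MvPolynomial.monomial s (1 : k)) '' S) ↔
      xpow k α ∈ Ideal.span ((fun s => MvPolynomial.monomial s (1 : k)) '' (T : Set (Fin m →₀ ℕ))) := by
    rw [← Finset.coe_image]
    exact iff_of_eq (congrArg (xpow k α ∈ ·) ht)
  rw [h, MvPolynomial.mem_ideal_span_monomial_image, xpow]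
  simp only [MvPolynomial.mem_support_iff, MvPolynomial.coeff_monomial, ne_eq, ite_eq_right_iff,
    one_ne_zero, imp_false, not_not, forall_eq', Finset.mem_coe]
  refine exists_congr fun s => and_congr_right fun _ => ?_
  rw [Finsupp.le_def]
  refine forall_congr' fun i => ?_
  rw [Finsupp.equivFunOnFinite_symm_apply_apply]
  have := hα i
  simp only [Pi.zero_apply] at this
  omega

/-! ### The conic complex of a cell order as a resolution. -/

namespace IsCellOrder

variable {k : Type u} [Field k] {B : ℕ → Type} [∀ n, Fintype (B n)] [PartialOrder (Cell B)]
  [Unique (B 0)] {δ : ∀ n, (B (n + 1) → k) →ₗ[k] (B n → k)} (h : IsCellOrder δ)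

/-- Cellular chains are isomorphic to the terms of the conic chain complex. -/
noncomputable def conicEquiv (n : ℕ) : (B (n + 1) → k) ≃ₗ[k] ConicX (Cell B) k n :=
  LinearEquiv.ofBijective (h.toConic n) ⟨h.toConic_injective n, h.toConic_surjective n⟩

include h

lemma finiteDimensional_conicComp (n : ℕ) (a : Cell B) :
    FiniteDimensional k ((conicComplex (Cell B) k).comp n a) :=
  have : FiniteDimensional k (ConicX (Cell B) k n) := Module.Finite.equiv (h.conicEquiv n)
  inferInstanceAs (FiniteDimensional k (conicComp k n a))

lemma mem_part_conicComplex {m : ℕ} {deg : Cell B →o (Fin m → ℤ)} {n : ℕ} {α : Fin m → ℤ}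
    {x : ConicX (Cell B) k n} : x ∈ (conicComplex (Cell B) k).part deg n α ↔
      ∃ v ∈ cellSub k {a | deg a ≤ α} (n + 1), h.toConic n v = x := by
  have := h.iSup_conicComp n {a | deg a ≤ α}
  change x ∈ ⨆ a ∈ {a | deg a ≤ α}, conicComp k n a ↔ _
  rw [this]
  rfl

lemma entry_conicComplex_eq_zero {n : ℕ} {a b : Cell B}
    (hab : ∀ v ∈ cellSub k {a} (n + 2), δ (n + 1) v ∈ cellSub k {b}ᶜ (n + 1)) :
    (conicComplex (Cell B) k).entry n a b = 0 := by
  refine LinearMap.ext fun ⟨x, hxa⟩ => ?_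
  have hx : x ∈ ⨆ c ∈ ({a} : Set (Cell B)), conicComp k (n + 1) c := by
    rw [iSup_singleton]
    exact hxa
  rw [h.iSup_conicComp] at hx
  obtain ⟨v, hv, hvx⟩ := hx
  change internalProj (conicComp_isInternal k n) b (conicD k n x) = 0
  rw [← hvx, h.conicD_toConic]
  suffices hle : (cellSub k ({b}ᶜ : Set (Cell B)) (n + 1)).map (h.toConic n) ≤
      LinearMap.ker (internalProj (conicComp_isInternal k n) b) from hle ⟨_, hab v hv, rfl⟩
  rw [← h.iSup_conicComp]
  exact iSup₂_le fun c hc y hy => internalProj_of_ne _ hc hy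

/-- The homogenization of the conic chain complex of a cell order is a minimal free resolution
whenever the underlying complex is exact in every degree and minimal. -/
theorem isMinimalFreeResolution [Fintype (Cell B)] {m : ℕ} (deg : Cell B →o (Fin m → ℤ))
    {I : Ideal (MvPolynomial (Fin m) k)} (hI : IsMonomialIdeal I) (hdeg : ∀ a, 0 ≤ deg a)
    (hdegI : ∀ a, xpow k (deg a) ∈ I)
    (hac : ∀ α, 0 ≤ α → xpow k α ∈ I → AcyclicOn δ {a | deg a ≤ α})
    (hmin : ∀ n, ∀ a b : Cell B, deg a = deg b → ∀ v ∈ cellSub k {a} (n + 2),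
      δ (n + 1) v ∈ cellSub k {b}ᶜ (n + 1)) :
    ((conicComplex (Cell B) k).homogenize deg).IsMinimalFreeResolution I := by
  have hex : ∀ α n, ∀ v ∈ cellSub k {a | deg a ≤ α} (n + 1), δ n v = 0 →
      ∃ y ∈ cellSub k {a | deg a ≤ α} (n + 2), δ (n + 1) y = v := by
    intro α n v hv hv0
    -- If no cell has degree at most `α`, the strand is zero. Otherwise `x^α` is a multiple of some
    -- `x^(deg a) ∈ I`, so the acyclicity hypothesis applies.
    by_cases hα : ∃ a, deg a ≤ α
    · obtain ⟨a, ha⟩ := hα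
      refine hac α ((hdeg a).trans ha) ?_ (n + 1) v hv hv0
      rw [← add_sub_cancel (deg a) α, ← xpow_mul k (hdeg a) (sub_nonneg.2 ha)]
      exact I.mul_mem_right _ (hdegI a)
    · exact ⟨0, Submodule.zero_mem _, by
        rw [map_zero]
        exact (funext fun b => hv b fun hb => hα ⟨_, hb⟩).symm⟩
  have := h.finiteDimensional_conicComp
  let ε : ConicX (Cell B) k 0 →ₗ[k] k := LinearMap.proj default ∘ₗ δ 0 ∘ₗ (h.conicEquiv 0).symm.toLinearMap
  have hε : ∀ v, ε (h.toConic 0 v) = δ 0 v default := fun v => by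
    change δ 0 ((h.conicEquiv 0).symm (h.conicEquiv 0 v)) default = _
    rw [LinearEquiv.symm_apply_apply]
  refine PGradedComplex.homogenize_isMinimalFreeResolution I hI hdeg ε (fun x => ?_)
    (fun a _ _ _ => hdegI a) (fun α hα hαI => ?_) (fun α x hx hx0 => ?_) (fun n α x hx hx0 => ?_)
    (fun n a b hab => ?_)
  · obtain ⟨v, rfl⟩ := h.toConic_surjective 1 x
    change ε (conicD k 0 (h.toConic 1 v)) = 0
    rw [h.conicD_toConic, hε, h.comp_eq_zero, Pi.zero_apply]
  · obtain ⟨y, hy, hy1⟩ := hac α hα hαI 0 1 trivial trivial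
    exact ⟨h.toConic 0 y, h.mem_part_conicComplex.2 ⟨y, hy, rfl⟩, (hε y).trans (by rw [hy1, Pi.one_apply])⟩
  · obtain ⟨v, hv, rfl⟩ := h.mem_part_conicComplex.1 hx
    obtain ⟨y, hy, rfl⟩ := hex α 0 v hv (funext fun b => by
      rw [Unique.eq_default b]
      exact (hε v).symm.trans hx0)
    exact ⟨h.toConic 1 y, h.mem_part_conicComplex.2 ⟨y, hy, rfl⟩, h.conicD_toConic 0 y⟩
  · obtain ⟨v, hv, rfl⟩ := h.mem_part_conicComplex.1 hx
    obtain ⟨y, hy, rfl⟩ := hex α (n + 1) v hv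
      (h.toConic_injective n (by rw [← h.conicD_toConic, map_zero]; exact hx0))
    exact ⟨h.toConic (n + 2) y, h.mem_part_conicComplex.2 ⟨y, hy, rfl⟩, h.conicD_toConic (n + 1) y⟩
  · exact h.entry_conicComplex_eq_zero (hmin n a b hab)

end IsCellOrder

end ConicRes

/-! ### Assembly for a monomial ideal. -/

theorem theoremT {k : Type u} [Field k] {m : ℕ} (I : Ideal (MvPolynomial (Fin m) k))
    (hI : ConicRes.IsMonomialIdeal I) :
    ∃ (Q : Type) (_ : PartialOrder Q) (_ : Fintype Q) (deg : Q →o (Fin m → ℤ)),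
      ConicRes.IsHCWPoset k Q ∧
      ((ConicRes.conicComplex Q k).homogenize deg).IsMinimalFreeResolution I ∧
      ∀ F : ConicRes.MultigradedComplex.{u, v} k m, F.IsMinimalFreeResolution I →
        Nonempty (F.Iso ((ConicRes.conicComplex Q k).homogenize deg)) := by
  classical
  obtain ⟨T, hT⟩ := hI.exists_finset
  -- `Γ` is the exponent of the least common multiple of the generators. The finite box below it
  -- serves as the set of degrees, and `J` marks the monomials of `I` in it.
  let Γ : Fin m → ℕ := fun i => T.sup fun s => s i
  let Λ : Type := Set.Iic Γ
  let J : Set Λ := {α | ∃ s ∈ T, ∀ i, s i ≤ α.1 i}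
  have hJ : IsUpperSet J := fun α β hαβ ⟨s, hs, hsα⟩ => ⟨s, hs, fun i => (hsα i).trans (hαβ i)⟩
  have : Finite Λ := (Set.finite_Iic Γ).to_subtype
  obtain ⟨C⟩ := ConicRes.nonempty_circuitComplex k hJ
  obtain ⟨_, hC, hmono⟩ := C.exists_isCellOrder hJ
  have : Finite (ConicRes.Cell C.B) := C.finite_cell
  let _ : Fintype (ConicRes.Cell C.B) := Fintype.ofFinite _
  let deg : ConicRes.Cell C.B →o (Fin m → ℤ) :=
    ⟨fun x i => ((C.cellDeg x).1 i : ℤ), fun x y hxy i => Int.ofNat_le.2 (hmono hxy i)⟩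
  have hres : ((ConicRes.conicComplex (ConicRes.Cell C.B) k).homogenize deg).IsMinimalFreeResolution I := by
    refine hC.isMinimalFreeResolution deg hI (fun a i => Int.natCast_nonneg _) (fun a => ?_)
      (fun α hα hαI => ?_) (fun n a b hab v hv => ?_)
    · obtain ⟨s, hs, hsa⟩ := C.deg_mem hJ a.dim a.idx
      exact (hT _ fun i => Int.natCast_nonneg _).2 ⟨s, hs, fun i => by exact_mod_cast hsa i⟩
    · obtain ⟨s, hs, hsα⟩ := (hT α hα).1 hαI
      -- All cells have degree at most `Γ`, so truncating `α` to the box keeps the same cells below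
      -- it. The truncation stays in `J` because `Γ` bounds every generator.
      let α' : Λ := ⟨fun i => min (α i).toNat (Γ i), fun i => min_le_right _ _⟩
      have hα' : α' ∈ J := ⟨s, hs, fun i => le_min (by have := hsα i; omega)
        (Finset.le_sup (f := fun s : Fin m →₀ ℕ => s i) hs)⟩
      have hset : {a | deg a ≤ α} = {a | C.cellDeg a ≤ α'} := by
        ext a
        refine forall_congr' fun i => ?_
        have h1 : (C.cellDeg a).1 i ≤ Γ i := (C.cellDeg a).2 i
        have h2 := hα i
        change ((C.cellDeg a).1 i : ℤ) ≤ α i ↔ (C.cellDeg a).1 i ≤ min (α i).toNat (Γ i)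
        simp only [Pi.zero_apply] at h2
        omega
      rw [hset]
      exact C.acyclicOn_deg_le hα'
    · intro c hc
      have hc' : (⟨n, c⟩ : ConicRes.Cell C.B) = b := not_not.1 hc
      rw [pi_eq_sum_univ' v, map_sum, Finset.sum_apply]
      refine Finset.sum_eq_zero fun i _ => ?_
      by_cases hi : (⟨n + 1, i⟩ : ConicRes.Cell C.B) = a
      · have hdeg : C.deg n c = C.deg (n + 1) i := Subtype.ext (funext fun j => by
          have := congrFun hab j
          rw [← hi, ← hc'] at this
          exact (Int.natCast_inj.1 this).symm)
        rw [map_smul, Pi.smul_apply]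
        convert smul_zero (v i)
        convert C.δ_single_eq_zero hdeg
      · rw [hv i hi, zero_smul, map_zero, Pi.zero_apply]
  exact ⟨ConicRes.Cell C.B, _, _, deg, hC.isHCWPoset, hres, fun F hF => hF.nonempty_iso hres⟩
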